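/- Let $\alpha\in\mathbb R$ and let $L$ be a slowly varying function on $[0,\infty)$, i.e. positive, measurable, with $L(\lambda t)/L(t)\to1$ as $t\to+\infty$ for every $\lambda>0$. Let $T=T_{\alpha,L}:\mathbb R\to(0,\infty)$ be a decreasing $C^2$ function such that $T(t)=e^{-t}$ for $t\le 0$, $T(t)=e^{-t}t^{\alpha}/L(t)$ for all $t\ge\mathfrak a$ (for some $\mathfrak a>0$), and $-B\le -T''(t)/T(t)\le -A<0$ for all $t$ (for some constants $A,B$). Let $d$ be the Riemannian distance on $\mathbb R^2$ of the metric $g_{\alpha,L}=T(t)^2\,dx^2+dt^2$, let $o=(0,0)$, let $p(x,t)=(x+1,t)$, and let $\mathcal P=\langle p\rangle=\{p^n : n\in\mathbb Z\}$. Then: 1. For integers $n\ge2$, $d(o,p^n o)=2\bigl(\log n+\alpha\log\log n-\log L(\log n)\bigr)+\epsilon(n)$ with $\epsilon(n)\to0$ as $n\to+\infty$. 2. The Poincaré exponent $\delta_{\mathcal P}=\limsup_{R\to\infty}\frac1R\log\#\{\gamma\in\mathcal P : d(x,\gamma y)\le R\}$ equals $\tfrac12$ for all $x,y\in\mathbb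 R^2$. 3. If $\alpha>1$, then $\mathcal P$ is convergent: $\sum_{\gamma\in\mathcal P}e^{-\delta_{\mathcal P}\,d(x,\gamma y)}<\infty$ for all $x,y\in\mathbb R^2$. 4. For every $\Delta>0$, $$\lim_{R\to+\infty}\frac{R^{\alpha}}{L(R)}\sum_{\substack{n\ge1\\ R\le d(o,p^no)<R+\Delta}}e^{-\frac12 d(o,p^no)}=2^{\alpha-1}\Delta,\qquad \lim_{R\to+\infty}\frac{R^{\alpha}}{L(R)}\sum_{\substack{\gamma\in\mathcal P\\ R\le d(o,\gamma o)<R+\Delta}}e^{-\frac12 d(o,\gamma o)}=2^{\alpha}\Delta .$$ In particular, for $1<\alpha<2$ the group $\mathcal P$ satisfies hypothesis $\mathbf{H_2}$ (existence, with exponent $\alpha$ and slowly varying function $L$, of a constant $c>0$ such that the second limit equals $c\Delta$ for every $\Delta>0$), with $c=2^\alpha$. -/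

import Mathlib

open Filter Topology
open scoped ENNReal Manifold

noncomputable section

/-- A slowly varying function on `[0, ∞)` (the values on negative reals play no role):
positive, measurable, with `L (c t) / L t → 1` as `t → +∞` for every `c > 0`. -/
structure IsSlowlyVarying (L : ℝ → ℝ) : Prop where
  measurable : Measurable L
  pos : ∀ t, 0 ≤ t → 0 < L t
  tendsto_ratio : ∀ c : ℝ, 0 < c → Tendsto (fun t => L (c * t) / L t) atTop (𝓝 1)

/-- `T` is a profile `T_{α, L}`: a positive decreasing `C²` function on `ℝ` which is `e^{-t}` for
`t ≤ 0` and `e^{-t} t^α / L t` for `t ≥ a`, and such that the curvature `-T'' / T` of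
`T² dx² + dt²` is pinched between `-B` and `-A < 0`. -/
structure IsCuspProfile (α : ℝ) (L : ℝ → ℝ) (A B a : ℝ) (T : ℝ → ℝ) : Prop where
  A_pos : 0 < A
  a_pos : 0 < a
  contDiff : ContDiff ℝ 2 T
  pos : ∀ t, 0 < T t
  strictAnti : StrictAnti T
  eq_hyperbolic : ∀ t, t ≤ 0 → T t = Real.exp (-t)
  eq_cusp : ∀ t, a ≤ t → T t = Real.exp (-t) * (t ^ α / L t)
  curvature_ge : ∀ t, -B ≤ -(deriv (deriv T) t / T t)
  curvature_le : ∀ t, -(deriv (deriv T) t / T t) ≤ -A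

/-- The metric tensor `T(t)² dx² + dt²` at the point `z = (x, t)` of the plane. -/
def warpedMetric (T : ℝ → ℝ) (z v w : ℝ × ℝ) : ℝ :=
  T z.2 ^ 2 * (v.1 * w.1) + v.2 * w.2

/-- The length of tangent vectors for the metric `T(t)² dx² + dt²`. -/
@[reducible] def warpedENorm (T : ℝ → ℝ) (z : ℝ × ℝ) :
    ENorm (TangentSpace 𝓘(ℝ, ℝ × ℝ) z) :=
  ⟨fun v : ℝ × ℝ => ENNReal.ofReal (Real.sqrt (warpedMetric T z v v))⟩

/-- The Riemannian distance of `T(t)² dx² + dt²` on the plane: the infimum of the lengths of `C¹`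
paths. -/
def warpedDist (T : ℝ → ℝ) (z w : ℝ × ℝ) : ℝ :=
  letI : ∀ y : ℝ × ℝ, ENorm (TangentSpace 𝓘(ℝ, ℝ × ℝ) y) := warpedENorm T
  (Manifold.riemannianEDist 𝓘(ℝ, ℝ × ℝ) z w).toReal

/-- The translation `(x, t) ↦ (x + 1, t)`. -/
def unitTranslation : Equiv.Perm (ℝ × ℝ) := Equiv.addRight ((1 : ℝ), (0 : ℝ))

section Orbits

/-- The orbital function `#{γ ∈ Γ | d(x, γ y) ≤ R}`. -/
def orbitalFunction {X : Type*} (d : X → X → ℝ) (Γ : Subgroup (Equiv.Perm X)) (x y : X) (R : ℝ) :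
    ℕ∞ :=
  Set.encard {γ : Equiv.Perm X | γ ∈ Γ ∧ d x (γ y) ≤ R}

/-- The Poincaré exponent `limsup_{R → ∞} (1 / R) log #{γ ∈ Γ | d(x, γ y) ≤ R}`. -/
def poincareExponent {X : Type*} (d : X → X → ℝ) (Γ : Subgroup (Equiv.Perm X)) (x y : X) : EReal :=
  limsup (fun R : ℝ => ENNReal.log ((orbitalFunction d Γ x y R : ℕ∞) : ℝ≥0∞) / (R : EReal)) atTop

/-- The Poincaré series `∑_{γ ∈ Γ} e^{-s d(x, γ y)}`. -/
def poincareSeries {X : Type*} (d : X → X → ℝ) (Γ : Subgroup (Equiv.Perm X)) (x y : X) (s : ℝ) :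
    ℝ≥0∞ :=
  ∑' γ : Γ, ENNReal.ofReal (Real.exp (-s * d x ((γ : Equiv.Perm X) y)))

/-- `Γ` is convergent: its Poincaré series is finite at the Poincaré exponent. -/
def IsConvergentGroup {X : Type*} (d : X → X → ℝ) (Γ : Subgroup (Equiv.Perm X)) : Prop :=
  ∃ δ : ℝ, ∀ x y : X, poincareExponent d Γ x y = (δ : EReal) ∧ poincareSeries d Γ x y δ < ⊤

/-- For every `Δ > 0`,
`(R^α / L R) ∑_{γ ∈ Γ, R ≤ d(o, γ o) < R + Δ} e^{-δ d(o, γ o)} → c Δ` as `R → +∞`. -/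
def HasOrbitalTail {X : Type*} (d : X → X → ℝ) (o : X) (Γ : Subgroup (Equiv.Perm X))
    (δ α : ℝ) (L : ℝ → ℝ) (c : ℝ) : Prop :=
  ∀ Δ : ℝ, 0 < Δ →
    Tendsto (fun R : ℝ => R ^ α / L R *
      ∑' γ : {γ : Equiv.Perm X // γ ∈ Γ ∧ R ≤ d o (γ o) ∧ d o (γ o) < R + Δ},
        Real.exp (-δ * d o ((γ : Equiv.Perm X) o))) atTop (𝓝 (c * Δ))

end Orbits

end

/-! Write w(t) = log(t^α / L t), so that T(t) = exp(-t + w(t)) for large t, and F(x) = log x + w(log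
x) (`halfDist`). Everything rests on d(o, (x, 0)) = 2 F(|x|) + o(1) (`tendsto_warpedDist_sub`),
because p^n o = (n, 0).

Lower bound: a curve of maximal height m is calibrated by T(m) dx ± √(1 - (T(m)/T)²) dt, the sign
changing at the top, so its length is at least T(m)|x| + 2(m - J(m)) with J = `heightDefect`. The
curvature bound forces T' ≤ -√A T, which dominates the integrand of J and gives J(m) → 1 - log 2,
the hyperbolic value. With y = T(m)|x|/2, the inequality y ≥ 1 + log y eliminates m up to w(m) and
leaves 2(log|x| + w(m)) + o(1). Finally m ~ log|x|, and uniform convergence for slowly varying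
functions replaces w(m) by w(log|x|).

Upper bound: two vertical segments joined by a hyperbolic geodesic arc with apex at height F(|x|) -
log 2. Along the arc the height varies by a bounded amount, and there T is nearly a constant times
e^{-t}.

Orbit sums: if d(o, p^n o) lies in [R, R + Δ), then log n ~ R/2, so w(log n) = w(R) - α log 2 +
o(1). Hence e^{-d/2} is asymptotic to 2^α (L(R)/R^α) / n, and log n runs through an interval of
length Δ/2 + o(1), over which the sum of 1/n tends to Δ/2. This yields 2^(α-1) Δ for positive powers
and twice that for the group. The exponent 1/2 only needs d ~ 2 log|n|, and convergence for α > 1 is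
that of ∑ 1/(n (log n)^β) for some β > 1. -/

noncomputable section

/-! ### Lengths and distances for T² dx² + dt², and the calibration bound. -/

section WarpedGeometry

variable {T : ℝ → ℝ}

lemma warpedMetric_smul (z : ℝ × ℝ) (r : ℝ) (v : ℝ × ℝ) :
    warpedMetric T z (r • v) (r • v) = r ^ 2 * warpedMetric T z v v := by
  simp only [warpedMetric, Prod.smul_fst, Prod.smul_snd, smul_eq_mul]; ring

lemma ofReal_sqrt_warpedMetric_smul (z : ℝ × ℝ) (r : ℝ) (v : ℝ × ℝ) :
    ENNReal.ofReal (Real.sqrt (warpedMetric T z (r • v) (r • v))) =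
      ‖r‖ₑ * ENNReal.ofReal (Real.sqrt (warpedMetric T z v v)) := by
  rw [warpedMetric_smul, Real.sqrt_mul (sq_nonneg r), Real.sqrt_sq_eq_abs,
    ENNReal.ofReal_mul (abs_nonneg r), Real.enorm_eq_ofReal_abs]

/-- Homogeneity makes path length invariant under reparametrization, which the symmetry and the
triangle inequality of the distance rely on. -/
lemma warpedENorm_smulClass (T : ℝ → ℝ) :
    letI : ∀ y : ℝ × ℝ, ENorm (TangentSpace 𝓘(ℝ, ℝ × ℝ) y) := warpedENorm T
    ∀ y : ℝ × ℝ, ENormSMulClass ℝ (TangentSpace 𝓘(ℝ, ℝ × ℝ) y) := by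
  let : ∀ y : ℝ × ℝ, ENorm (TangentSpace 𝓘(ℝ, ℝ × ℝ) y) := warpedENorm T
  intro y
  exact ⟨fun r v => ofReal_sqrt_warpedMetric_smul y r v⟩

/-- The extended distance underlying `warpedDist`. -/
def warpedEDist (T : ℝ → ℝ) (z w : ℝ × ℝ) : ℝ≥0∞ :=
  letI : ∀ y : ℝ × ℝ, ENorm (TangentSpace 𝓘(ℝ, ℝ × ℝ) y) := warpedENorm T
  Manifold.riemannianEDist 𝓘(ℝ, ℝ × ℝ) z w

lemma warpedDist_eq_toReal (z w : ℝ × ℝ) : warpedDist T z w = (warpedEDist T z w).toReal := rfl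

lemma warpedEDist_self (z : ℝ × ℝ) : warpedEDist T z z = 0 := by
  let : ∀ y : ℝ × ℝ, ENorm (TangentSpace 𝓘(ℝ, ℝ × ℝ) y) := warpedENorm T
  have := warpedENorm_smulClass T
  exact Manifold.riemannianEDist_self

lemma warpedEDist_comm (z w : ℝ × ℝ) : warpedEDist T z w = warpedEDist T w z := by
  let : ∀ y : ℝ × ℝ, ENorm (TangentSpace 𝓘(ℝ, ℝ × ℝ) y) := warpedENorm T
  have := warpedENorm_smulClass T
  exact Manifold.riemannianEDist_comm

lemma warpedEDist_triangle (z w v : ℝ × ℝ) :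
    warpedEDist T z v ≤ warpedEDist T z w + warpedEDist T w v := by
  let : ∀ y : ℝ × ℝ, ENorm (TangentSpace 𝓘(ℝ, ℝ × ℝ) y) := warpedENorm T
  have := warpedENorm_smulClass T
  exact Manifold.riemannianEDist_triangle

/-- The speed of the curve `(g, h)` for the metric `T(t)² dx² + dt²`. -/
def warpedSpeed (T g h : ℝ → ℝ) (s : ℝ) : ℝ :=
  Real.sqrt (T (h s) ^ 2 * deriv g s ^ 2 + deriv h s ^ 2)

lemma enorm_mfderiv_eq_warpedSpeed {γ : ℝ → ℝ × ℝ} {s : ℝ} (hγ : DifferentiableAt ℝ γ s) :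
    letI : ∀ y : ℝ × ℝ, ENorm (TangentSpace 𝓘(ℝ, ℝ × ℝ) y) := warpedENorm T
    ‖mfderiv 𝓘(ℝ, ℝ) 𝓘(ℝ, ℝ × ℝ) γ s 1‖ₑ =
      ENNReal.ofReal (warpedSpeed T (fun s => (γ s).1) (fun s => (γ s).2) s) := by
  let : ∀ y : ℝ × ℝ, ENorm (TangentSpace 𝓘(ℝ, ℝ × ℝ) y) := warpedENorm T
  have h1 : HasDerivAt (fun s => (γ s).1) (fderiv ℝ γ s 1).1 s :=
    (hasFDerivAt_fst (𝕜 := ℝ) (E := ℝ) (F := ℝ)).comp_hasDerivAt s hγ.hasDerivAt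
  have h2 : HasDerivAt (fun s => (γ s).2) (fderiv ℝ γ s 1).2 s :=
    (hasFDerivAt_snd (𝕜 := ℝ) (E := ℝ) (F := ℝ)).comp_hasDerivAt s hγ.hasDerivAt
  rw [mfderiv_eq_fderiv]
  change ENNReal.ofReal (Real.sqrt (warpedMetric T (γ s) (fderiv ℝ γ s 1) (fderiv ℝ γ s 1))) = _
  rw [warpedSpeed, h1.deriv, h2.deriv, warpedMetric]
  congr 3 <;> ring

lemma warpedEDist_le_of_speed_le {g h : ℝ → ℝ} (hg : ContDiff ℝ 1 g) (hh : ContDiff ℝ 1 h)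
    {a b K : ℝ} (hab : a ≤ b) (hK : ∀ s ∈ Set.Icc a b, warpedSpeed T g h s ≤ K) :
    warpedEDist T (g a, h a) (g b, h b) ≤ ENNReal.ofReal (K * (b - a)) := by
  let : ∀ y : ℝ × ℝ, ENorm (TangentSpace 𝓘(ℝ, ℝ × ℝ) y) := warpedENorm T
  have := warpedENorm_smulClass T
  have hγ : ContDiff ℝ 1 (fun s => (g s, h s)) := hg.prodMk hh
  have h1 : warpedEDist T (g a, h a) (g b, h b) ≤
      Manifold.pathELength 𝓘(ℝ, ℝ × ℝ) (fun s => (g s, h s)) a b :=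
    Manifold.riemannianEDist_le_pathELength (contMDiff_iff_contDiff.2 hγ).contMDiffOn rfl rfl hab
  refine h1.trans ?_
  rw [Manifold.pathELength_eq_lintegral_mfderiv_Icc]
  calc _ ≤ ∫⁻ _ in Set.Icc a b, ENNReal.ofReal K := by
        refine MeasureTheory.setLIntegral_mono measurable_const fun s hs => ?_
        exact (enorm_mfderiv_eq_warpedSpeed (hγ.differentiable one_ne_zero s)).le.trans
          (ENNReal.ofReal_le_ofReal (hK s hs))
    _ = ENNReal.ofReal (K * (b - a)) := by
        rw [MeasureTheory.setLIntegral_const, Real.volume_Icc,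
          ENNReal.ofReal_mul ((Real.sqrt_nonneg _).trans (hK a ⟨le_rfl, hab⟩))]

lemma continuous_warpedSpeed (hT : Continuous T) {g h : ℝ → ℝ} (hg : ContDiff ℝ 1 g)
    (hh : ContDiff ℝ 1 h) : Continuous (warpedSpeed T g h) := by
  have h1 := hg.continuous_deriv le_rfl
  have h2 := hh.continuous_deriv le_rfl
  have h3 := hh.continuous
  unfold warpedSpeed
  fun_prop

lemma exists_curve_of_warpedEDist_lt (hT : Continuous T) {z w : ℝ × ℝ} {r : ℝ}
    (hr : warpedEDist T z w < ENNReal.ofReal r) :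
    ∃ g h : ℝ → ℝ, ContDiff ℝ 1 g ∧ ContDiff ℝ 1 h ∧ (g 0, h 0) = z ∧ (g 1, h 1) = w ∧
      ∫ s in (0 : ℝ)..1, warpedSpeed T g h s < r := by
  let : ∀ y : ℝ × ℝ, ENorm (TangentSpace 𝓘(ℝ, ℝ × ℝ) y) := warpedENorm T
  have := warpedENorm_smulClass T
  obtain ⟨γ, h0, h1, hγ, hlen, -, -⟩ :=
    Manifold.exists_lt_locally_constant_of_riemannianEDist_lt (I := 𝓘(ℝ, ℝ × ℝ)) hr zero_lt_one
  rw [contMDiff_iff_contDiff] at hγ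
  have hg : ContDiff ℝ 1 (fun s => (γ s).1) := contDiff_fst.comp hγ
  have hh : ContDiff ℝ 1 (fun s => (γ s).2) := contDiff_snd.comp hγ
  refine ⟨fun s => (γ s).1, fun s => (γ s).2, hg, hh, h0, h1, ?_⟩
  rw [Manifold.pathELength_eq_lintegral_mfderiv_Icc] at hlen
  have hcont := continuous_warpedSpeed hT hg hh
  have hr0 : 0 < r := by
    by_contra hneg
    rw [ENNReal.ofReal_of_nonpos (not_lt.1 hneg)] at hr
    exact not_lt_zero hr
  rw [intervalIntegral.integral_of_le zero_le_one, ← MeasureTheory.integral_Icc_eq_integral_Ioc,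
    ← ENNReal.ofReal_lt_ofReal_iff hr0, MeasureTheory.ofReal_integral_eq_lintegral_ofReal
      (hcont.integrableOn_Icc) (Filter.Eventually.of_forall fun s => Real.sqrt_nonneg _)]
  refine lt_of_eq_of_lt ?_ hlen
  refine MeasureTheory.lintegral_congr fun s => ?_
  exact (enorm_mfderiv_eq_warpedSpeed (hγ.differentiable one_ne_zero s)).symm

lemma warpedEDist_vertical_le (x t t' : ℝ) :
    warpedEDist T (x, t) (x, t') ≤ ENNReal.ofReal |t - t'| := by
  wlog h : t ≤ t' generalizing t t'
  · rw [warpedEDist_comm, abs_sub_comm]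
    exact this t' t (le_of_not_ge h)
  have := warpedEDist_le_of_speed_le (T := T) (g := fun _ => x) (h := fun s => s) (K := 1)
    contDiff_const contDiff_id h (fun s _ => by simp [warpedSpeed])
  rw [abs_sub_comm, abs_of_nonneg (sub_nonneg.2 h)]
  simpa using this

lemma warpedEDist_horizontal_le (hT : ∀ t, 0 < T t) (x x' t : ℝ) :
    warpedEDist T (x, t) (x', t) ≤ ENNReal.ofReal (T t * |x - x'|) := by
  wlog h : x ≤ x' generalizing x x'
  · rw [warpedEDist_comm, abs_sub_comm]
    exact this x' x (le_of_not_ge h)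
  have := warpedEDist_le_of_speed_le (T := T) (g := fun s => s) (h := fun _ => t) (K := T t)
    contDiff_id contDiff_const h (fun s _ => by simp [warpedSpeed, Real.sqrt_sq (hT t).le])
  rwa [abs_sub_comm, abs_of_nonneg (sub_nonneg.2 h)]

/-- A horizontal segment followed by a vertical one joins any two points. Finiteness ensures that
`toReal` loses nothing, so the triangle inequality passes to `warpedDist`. -/
lemma warpedEDist_ne_top (hT : ∀ t, 0 < T t) (z w : ℝ × ℝ) : warpedEDist T z w ≠ ⊤ := by
  refine ne_top_of_le_ne_top ?_ (warpedEDist_triangle z (w.1, z.2) w)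
  exact ENNReal.add_ne_top.2
    ⟨ne_top_of_le_ne_top ENNReal.ofReal_ne_top (warpedEDist_horizontal_le hT z.1 w.1 z.2),
      ne_top_of_le_ne_top ENNReal.ofReal_ne_top (warpedEDist_vertical_le w.1 z.2 w.2)⟩

lemma warpedDist_self (z : ℝ × ℝ) : warpedDist T z z = 0 := by
  rw [warpedDist_eq_toReal, warpedEDist_self, ENNReal.toReal_zero]

lemma warpedDist_comm (z w : ℝ × ℝ) : warpedDist T z w = warpedDist T w z := by
  rw [warpedDist_eq_toReal, warpedEDist_comm, ← warpedDist_eq_toReal]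

lemma warpedDist_triangle (hT : ∀ t, 0 < T t) (z w v : ℝ × ℝ) :
    warpedDist T z v ≤ warpedDist T z w + warpedDist T w v := by
  simp only [warpedDist_eq_toReal]
  rw [← ENNReal.toReal_add (warpedEDist_ne_top hT _ _) (warpedEDist_ne_top hT _ _)]
  exact ENNReal.toReal_mono (ENNReal.add_ne_top.2
    ⟨warpedEDist_ne_top hT _ _, warpedEDist_ne_top hT _ _⟩) (warpedEDist_triangle z w v)

lemma warpedDist_vertical_le (x t t' : ℝ) : warpedDist T (x, t) (x, t') ≤ |t - t'| :=
  ENNReal.toReal_le_of_le_ofReal (abs_nonneg _) (warpedEDist_vertical_le x t t')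

lemma warpedDist_horizontal_le (hT : ∀ t, 0 < T t) (x x' t : ℝ) :
    warpedDist T (x, t) (x', t) ≤ T t * |x - x'| :=
  ENNReal.toReal_le_of_le_ofReal (mul_nonneg (hT t).le (abs_nonneg _))
    (warpedEDist_horizontal_le hT x x' t)

lemma warpedDist_le_of_speed_le {g h : ℝ → ℝ} (hg : ContDiff ℝ 1 g) (hh : ContDiff ℝ 1 h)
    {a b K : ℝ} (hab : a ≤ b) (hK : ∀ s ∈ Set.Icc a b, warpedSpeed T g h s ≤ K) :
    warpedDist T (g a, h a) (g b, h b) ≤ K * (b - a) :=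
  ENNReal.toReal_le_of_le_ofReal
    (mul_nonneg ((Real.sqrt_nonneg _).trans (hK a ⟨le_rfl, hab⟩)) (sub_nonneg.2 hab))
    (warpedEDist_le_of_speed_le hg hh hab hK)

/-- Cauchy–Schwarz for (τ p, q) against the unit vector (c/τ, √(1 - (c/τ)²)): the pointwise form of
the calibration. -/
lemma add_mul_sqrt_le_sqrt {c τ p q : ℝ} (hτ : 0 < τ) (hc : 0 ≤ c) (hcτ : c ≤ τ) :
    c * p + Real.sqrt (1 - (c / τ) ^ 2) * q ≤ Real.sqrt (τ ^ 2 * p ^ 2 + q ^ 2) := by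
  have h1 : c / τ ≤ 1 := (div_le_one hτ).2 hcτ
  have h0 : 0 ≤ c / τ := div_nonneg hc hτ.le
  have hs : Real.sqrt (1 - (c / τ) ^ 2) ^ 2 = 1 - (c / τ) ^ 2 :=
    Real.sq_sqrt (by nlinarith)
  have hcp : c * p = (c / τ) * (τ * p) := by field_simp
  refine Real.le_sqrt_of_sq_le ?_
  rw [hcp]
  set k := c / τ
  set r := Real.sqrt (1 - k ^ 2)
  nlinarith [sq_nonneg (r * (τ * p) - k * q)]

/-- A curve from `(0, 0)` to `(x, 0)` with maximal height `m` is at least as long as the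
broken geodesic calibrated by `c x ± W(t)`, with `c = T m` and `W' = √(1 - (c / T)²)`. -/
lemma exists_height_le_length (hT : Continuous T) (hpos : ∀ t, 0 < T t) (hanti : StrictAnti T)
    {g h : ℝ → ℝ} (hg : ContDiff ℝ 1 g) (hh : ContDiff ℝ 1 h) {x : ℝ} (hg0 : g 0 = 0)
    (hg1 : g 1 = x) (hh0 : h 0 = 0) (hh1 : h 1 = 0) :
    ∃ m, 0 ≤ m ∧ T m * |x| + 2 * ∫ t in (0 : ℝ)..m, Real.sqrt (1 - (T m / T t) ^ 2) ≤
      ∫ s in (0 : ℝ)..1, warpedSpeed T g h s := by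
  obtain ⟨τ, hτ, hmax⟩ := isCompact_Icc.exists_isMaxOn (Set.nonempty_Icc.2 (zero_le_one (α := ℝ)))
    hh.continuous.continuousOn
  have hle : ∀ s ∈ Set.Icc (0 : ℝ) 1, h s ≤ h τ := fun s hs => hmax hs
  have hspeed := continuous_warpedSpeed hT hg hh
  have hdg := hg.continuous_deriv le_rfl
  have hdh := hh.continuous_deriv le_rfl
  have hch := hh.continuous
  refine ⟨h τ, by simpa [hh0] using hle 0 (by simp), ?_⟩
  set m := h τ
  set w : ℝ → ℝ := fun t => Real.sqrt (1 - (T m / T t) ^ 2) with hw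
  have hwc : Continuous w := by
    have := fun t => (hpos t).ne'
    rw [hw]; fun_prop (disch := assumption)
  set W : ℝ → ℝ := fun t => ∫ t in (0 : ℝ)..t, w t with hW
  have hWd : ∀ t, HasDerivAt W (w t) t := fun t => hwc.integral_hasStrictDerivAt 0 t |>.hasDerivAt
  -- The signs σ and κ adapt the calibration to the direction of x and to the ascent or descent. It
  -- applies along the whole curve because T ≥ T m below height m.
  have key : ∀ (σ κ : ℝ), |σ| = 1 → |κ| = 1 → ∀ u v, 0 ≤ u → u ≤ v → v ≤ 1 →
      (T m * σ * g v + κ * W (h v)) - (T m * σ * g u + κ * W (h u)) ≤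
        ∫ s in u..v, warpedSpeed T g h s := by
    intro σ κ hσ hκ u v hu huv hv
    have hd : ∀ s ∈ Set.uIcc u v, HasDerivAt (fun s => T m * σ * g s + κ * W (h s))
        (T m * σ * deriv g s + κ * (w (h s) * deriv h s)) s := fun s _ =>
      (((hg.differentiable one_ne_zero s).hasDerivAt).const_mul _).add
        (((hWd (h s)).comp s (hh.differentiable one_ne_zero s).hasDerivAt).const_mul κ)
    have hc : Continuous fun s => T m * σ * deriv g s + κ * (w (h s) * deriv h s) := by fun_prop
    rw [← intervalIntegral.integral_eq_sub_of_hasDerivAt hd (hc.intervalIntegrable _ _)]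
    refine intervalIntegral.integral_mono_on huv (hc.intervalIntegrable _ _)
      (hspeed.intervalIntegrable _ _) fun s hs => ?_
    have hs1 : T m ≤ T (h s) := hanti.antitone (hle s ⟨hu.trans hs.1, hs.2.trans hv⟩)
    have := add_mul_sqrt_le_sqrt (p := σ * deriv g s) (q := κ * deriv h s) (hpos (h s))
      (hpos m).le hs1
    have h1 : (σ * deriv g s) ^ 2 = deriv g s ^ 2 := by
      rw [mul_pow, ← sq_abs σ, hσ]; ring
    have h2 : (κ * deriv h s) ^ 2 = deriv h s ^ 2 := by
      rw [mul_pow, ← sq_abs κ, hκ]; ring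
    rw [h1, h2] at this
    refine le_trans (le_of_eq ?_) this
    simp only [hw]; ring
  obtain ⟨σ, hσ, hσx⟩ : ∃ σ : ℝ, |σ| = 1 ∧ σ * x = |x| := by
    rcases le_total 0 x with hx | hx
    · exact ⟨1, by simp, by rw [abs_of_nonneg hx, one_mul]⟩
    · exact ⟨-1, by simp, by rw [abs_of_nonpos hx]; ring⟩
  -- Ascending sign before the time τ of maximal height, descending sign after it: the two
  -- contributions W m add up instead of cancelling.
  have h1 := key σ 1 hσ (by simp) 0 τ le_rfl hτ.1 hτ.2
  have h2 := key σ (-1) hσ (by simp) τ 1 hτ.1 hτ.2 le_rfl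
  have hW0 : W 0 = 0 := by simp [hW]
  have hadd := intervalIntegral.integral_add_adjacent_intervals
    (hspeed.intervalIntegrable (μ := MeasureTheory.volume) 0 τ)
    (hspeed.intervalIntegrable (μ := MeasureTheory.volume) τ 1)
  rw [← hadd]
  rw [hg0, hh0, hW0] at h1
  rw [hg1, hh1, hW0] at h2
  have h3 : T m * σ * x = T m * |x| := by rw [← hσx]; ring
  change T m * |x| + 2 * W m ≤ _
  change _ ≤ ∫ s in (0 : ℝ)..τ, warpedSpeed T g h s at h1
  linarith

lemma exists_height_lt_warpedDist_add (hT : Continuous T) (hpos : ∀ t, 0 < T t)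
    (hanti : StrictAnti T) (x : ℝ) {ε : ℝ} (hε : 0 < ε) :
    ∃ m, 0 ≤ m ∧ T m * |x| + 2 * ∫ t in (0 : ℝ)..m, Real.sqrt (1 - (T m / T t) ^ 2) <
      warpedDist T (0, 0) (x, 0) + ε := by
  have hlt : warpedEDist T (0, 0) (x, 0) < ENNReal.ofReal (warpedDist T (0, 0) (x, 0) + ε) := by
    rw [ENNReal.lt_ofReal_iff_toReal_lt (warpedEDist_ne_top hpos _ _), ← warpedDist_eq_toReal]
    linarith
  obtain ⟨g, h, hg, hh, h0, h1, hlen⟩ := exists_curve_of_warpedEDist_lt hT hlt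
  simp only [Prod.mk.injEq] at h0 h1
  obtain ⟨m, hm, hle⟩ := exists_height_le_length hT hpos hanti hg hh h0.1 h1.1 h0.2 h1.2
  exact ⟨m, hm, hle.trans_lt hlen⟩

end WarpedGeometry

/-! ### Uniform convergence and growth bounds for slowly varying functions. -/

section SlowVariation

/-- Uniform convergence theorem for additively slowly varying continuous functions. -/
lemma exists_forall_abs_sub_le_of_tendsto_shift {f : ℝ → ℝ} (hf : Continuous f)
    (h : ∀ u, Tendsto (fun x => f (x + u) - f x) atTop (𝓝 0)) {ε : ℝ} (hε : 0 < ε) :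
    ∃ δ > 0, ∃ X, ∀ x, X ≤ x → ∀ v, |v| < δ → |f (x + v) - f x| ≤ ε := by
  -- Baire category: these closed sets cover ℝ, so one of them contains an interval around some u.
  -- Comparing both f (x + v) and f x with f (x - u) moves that interval to 0.
  set E : ℕ → Set ℝ := fun n => {u | ∀ x, (n : ℝ) ≤ x → |f (x + u) - f x| ≤ ε / 2} with hE
  have hclosed : ∀ n, IsClosed (E n) := by
    intro n
    have : E n = ⋂ x, ⋂ (_ : (n : ℝ) ≤ x), {u | |f (x + u) - f x| ≤ ε / 2} := by
      ext u; simp [hE]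
    rw [this]
    exact isClosed_iInter fun x => isClosed_iInter fun _ =>
      isClosed_le (by fun_prop) continuous_const
  have hcover : ⋃ n, E n = Set.univ := by
    refine Set.eq_univ_of_forall fun u => Set.mem_iUnion.2 ?_
    obtain ⟨X, hX⟩ := eventually_atTop.1 ((h u).eventually (Metric.closedBall_mem_nhds 0
      (half_pos hε)))
    obtain ⟨n, hn⟩ := exists_nat_ge X
    exact ⟨n, fun x hx => by simpa using hX x (hn.trans hx)⟩
  obtain ⟨n, u, hu⟩ := nonempty_interior_of_iUnion_of_closed hclosed hcover
  obtain ⟨δ, hδ, hball⟩ := Metric.isOpen_iff.1 isOpen_interior u hu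
  have hball' : ∀ v, |v| < δ → u + v ∈ E n := fun v hv =>
    interior_subset (hball (by simpa [Real.dist_eq] using hv))
  refine ⟨δ, hδ, n + u, fun x hx v hv => ?_⟩
  have h1 := hball' v hv (x - u) (by linarith)
  have h2 := hball' 0 (by simpa using hδ) (x - u) (by linarith)
  rw [show x - u + (u + v) = x + v by ring] at h1
  rw [show x - u + (u + 0) = x by ring] at h2
  rw [show f (x + v) - f x = (f (x + v) - f (x - u)) - (f x - f (x - u)) by ring]
  exact (abs_sub _ _).trans (by linarith)

/-- Beyond some point each unit step changes f by at most ε; compactness bounds f before it. For f =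
log ∘ L ∘ exp this is a Potter-type bound. -/
lemma exists_forall_abs_le_mul_add_of_tendsto_shift {f : ℝ → ℝ} (hf : Continuous f)
    (h : Tendsto (fun x => f (x + 1) - f x) atTop (𝓝 0)) {ε : ℝ} (hε : 0 < ε) :
    ∃ C, ∀ x, 0 ≤ x → |f x| ≤ ε * x + C := by
  obtain ⟨X, hX⟩ := eventually_atTop.1 (h.eventually (Metric.closedBall_mem_nhds 0 hε))
  obtain ⟨N, hN⟩ := exists_nat_ge X
  obtain ⟨C, hC⟩ := isCompact_Icc.exists_bound_of_continuousOn (s := Set.Icc (0 : ℝ) (N + 1))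
    hf.continuousOn
  refine ⟨C, fun x hx => ?_⟩
  have key : ∀ k : ℕ, ∀ x : ℝ, 0 ≤ x → x ≤ N + 1 + k → |f x| ≤ ε * x + C := by
    intro k
    induction k with
    | zero =>
      intro x hx hxk
      have := hC x ⟨hx, by simpa using hxk⟩
      rw [Real.norm_eq_abs] at this
      have : 0 ≤ ε * x := by positivity
      linarith
    | succ k ih =>
      intro x hx hxk
      push_cast at hxk
      rcases le_total x (N + 1 + k) with hle | hle
      · exact ih x hx hle
      · have hk : (0 : ℝ) ≤ k := Nat.cast_nonneg k
        have hN0 : (0 : ℝ) ≤ N := Nat.cast_nonneg N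
        have h1 := ih (x - 1) (by linarith) (by linarith)
        have h2 := hX (x - 1) (by linarith)
        rw [sub_add_cancel, dist_zero_right, Real.norm_eq_abs] at h2
        have h3 := abs_add_le (f x - f (x - 1)) (f (x - 1))
        rw [sub_add_cancel] at h3
        linarith
  obtain ⟨k, hk⟩ := exists_nat_ge x
  exact key k x hx (by have : (0 : ℝ) ≤ N := Nat.cast_nonneg N; linarith)

variable {L : ℝ → ℝ} {a : ℝ}

/-- The substitution t = exp x makes multiplicative slow variation additive. The truncation by `max
a` confines L to `[a, ∞)`, where it will be continuous, and is invisible at infinity. -/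
lemma IsSlowlyVarying.tendsto_log_shift (hL : IsSlowlyVarying L) (a u : ℝ) :
    Tendsto (fun x => Real.log (L (max a (Real.exp (x + u)))) -
      Real.log (L (max a (Real.exp x)))) atTop (𝓝 0) := by
  have h1 := (hL.tendsto_ratio (Real.exp u) (Real.exp_pos u)).comp Real.tendsto_exp_atTop
  have h2 := ((Real.continuousAt_log one_ne_zero).tendsto.comp h1)
  rw [Real.log_one] at h2
  refine h2.congr' ?_
  have e1 : ∀ᶠ x in atTop, a ≤ Real.exp x := Real.tendsto_exp_atTop.eventually_ge_atTop a
  have e2 : ∀ᶠ x in atTop, a ≤ Real.exp (x + u) :=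
    (Real.tendsto_exp_atTop.comp (tendsto_atTop_add_const_right _ u tendsto_id)).eventually_ge_atTop
      a
  filter_upwards [e1, e2] with x hx1 hx2
  simp only [Function.comp_apply]
  rw [max_eq_right hx1, max_eq_right hx2, ← Real.exp_add, add_comm u x,
    Real.log_div (hL.pos _ (Real.exp_pos _).le).ne' (hL.pos _ (Real.exp_pos _).le).ne']

lemma IsSlowlyVarying.continuous_log_comp_exp (hL : IsSlowlyVarying L) (ha : 0 < a)
    (hc : ContinuousOn L (Set.Ici a)) :
    Continuous fun x => Real.log (L (max a (Real.exp x))) := by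
  refine Continuous.log ?_ fun x => (hL.pos _ (ha.le.trans (le_max_left _ _))).ne'
  exact hc.comp_continuous (by fun_prop) fun x => Set.mem_Ici.2 (le_max_left _ _)

lemma IsSlowlyVarying.tendsto_log_sub_log (hL : IsSlowlyVarying L) (ha : 0 < a)
    (hc : ContinuousOn L (Set.Ici a)) {ι : Type*} {l : Filter ι} {y z : ι → ℝ}
    (hz : Tendsto z l atTop) (hyz : Tendsto (fun i => y i / z i) l (𝓝 1)) :
    Tendsto (fun i => Real.log (L (y i)) - Real.log (L (z i))) l (𝓝 0) := by
  have hy : Tendsto y l atTop := by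
    have := Tendsto.pos_mul_atTop one_pos hyz hz
    refine this.congr' ?_
    filter_upwards [hz.eventually_gt_atTop 0] with i hi
    field_simp
  have hlog : Tendsto (fun i => Real.log (y i / z i)) l (𝓝 0) := by
    have := (Real.continuousAt_log one_ne_zero).tendsto.comp hyz
    rwa [Real.log_one] at this
  rw [Metric.tendsto_nhds]
  intro ε hε
  obtain ⟨δ, hδ, X, hX⟩ := exists_forall_abs_sub_le_of_tendsto_shift
    (hL.continuous_log_comp_exp ha hc) (hL.tendsto_log_shift a) (half_pos hε)
  have e1 : ∀ᶠ i in l, |Real.log (y i / z i)| < δ := by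
    simpa [Real.dist_eq] using (Metric.tendsto_nhds.1 hlog δ hδ)
  filter_upwards [e1, (Real.tendsto_log_atTop.comp hz).eventually_ge_atTop X,
    hz.eventually_ge_atTop a, hy.eventually_ge_atTop a] with i h1 h2 h3 h4
  have hz0 := ha.trans_le h3
  have hy0 := ha.trans_le h4
  have := hX _ h2 _ h1
  rw [Function.comp_apply, Real.log_div hy0.ne' hz0.ne', add_sub_cancel, Real.exp_log hy0,
    Real.exp_log hz0, max_eq_right h3, max_eq_right h4] at this
  rw [Real.dist_eq, sub_zero]
  linarith

lemma IsSlowlyVarying.exists_abs_log_le (hL : IsSlowlyVarying L) (ha : 0 < a)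
    (hc : ContinuousOn L (Set.Ici a)) {ε : ℝ} (hε : 0 < ε) :
    ∃ C, ∀ t, a ≤ t → 1 ≤ t → |Real.log (L t)| ≤ ε * Real.log t + C := by
  obtain ⟨C, hC⟩ := exists_forall_abs_le_mul_add_of_tendsto_shift
    (hL.continuous_log_comp_exp ha hc) (hL.tendsto_log_shift a 1) hε
  refine ⟨C, fun t hat ht => ?_⟩
  have := hC (Real.log t) (Real.log_nonneg ht)
  rwa [Real.exp_log (by linarith), max_eq_right hat] at this

/-- The logarithm of `t ^ α / L t`. -/
def logWeight (α : ℝ) (L : ℝ → ℝ) (t : ℝ) : ℝ := α * Real.log t - Real.log (L t)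

/-- The comparison of y with c z uses uniform convergence, that of c z with z the definition of slow
variation; only t^α contributes to the limit. -/
lemma IsSlowlyVarying.tendsto_logWeight_sub (hL : IsSlowlyVarying L) (ha : 0 < a)
    (hc : ContinuousOn L (Set.Ici a)) (α : ℝ) {c : ℝ} (hc0 : 0 < c)
    {ι : Type*} {l : Filter ι} {y z : ι → ℝ}
    (hz : Tendsto z l atTop) (hyz : Tendsto (fun i => y i / z i) l (𝓝 c)) :
    Tendsto (fun i => logWeight α L (y i) - logWeight α L (z i)) l (𝓝 (α * Real.log c)) := by
  have hcz : Tendsto (fun i => c * z i) l atTop := hz.const_mul_atTop hc0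
  have hy : Tendsto y l atTop := by
    have := Tendsto.pos_mul_atTop hc0 hyz hz
    refine this.congr' ?_
    filter_upwards [hz.eventually_gt_atTop 0] with i hi
    field_simp
  have hycz : Tendsto (fun i => y i / (c * z i)) l (𝓝 1) := by
    have := hyz.div_const c
    rw [div_self hc0.ne'] at this
    exact this.congr fun i => by rw [div_div, mul_comm]
  have h1 := hL.tendsto_log_sub_log ha hc hcz hycz
  have h2 := (Real.continuousAt_log one_ne_zero).tendsto.comp ((hL.tendsto_ratio c hc0).comp hz)
  have h3 := (Real.continuousAt_log hc0.ne').tendsto.comp hyz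
  rw [Real.log_one] at h2
  have h4 := (h3.const_mul α).sub (h1.add h2)
  rw [add_zero, sub_zero] at h4
  refine h4.congr' ?_
  filter_upwards [hz.eventually_gt_atTop 0, hy.eventually_gt_atTop 0] with i h5 h6
  simp only [Function.comp_apply, logWeight]
  rw [Real.log_div h6.ne' h5.ne', Real.log_div (hL.pos _ (mul_pos hc0 h5).le).ne'
    (hL.pos _ h5.le).ne']
  ring

lemma IsSlowlyVarying.exists_abs_logWeight_le (hL : IsSlowlyVarying L) (ha : 0 < a)
    (hc : ContinuousOn L (Set.Ici a)) (α : ℝ) :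
    ∃ C, ∀ t, a ≤ t → 1 ≤ t → |logWeight α L t| ≤ (|α| + 1) * Real.log t + C := by
  obtain ⟨C, hC⟩ := hL.exists_abs_log_le ha hc one_pos
  refine ⟨C, fun t hat ht => ?_⟩
  have h1 := hC t hat ht
  have h2 := abs_sub (α * Real.log t) (Real.log (L t))
  rw [abs_mul, abs_of_nonneg (Real.log_nonneg ht)] at h2
  unfold logWeight
  linarith

lemma IsSlowlyVarying.tendsto_logWeight_div (hL : IsSlowlyVarying L) (ha : 0 < a)
    (hc : ContinuousOn L (Set.Ici a)) (α : ℝ) :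
    Tendsto (fun t => logWeight α L t / t) atTop (𝓝 0) := by
  obtain ⟨C, hC⟩ := hL.exists_abs_logWeight_le ha hc α
  have h1 : Tendsto (fun t : ℝ => (|α| + 1) * (Real.log t / t) + C / t) atTop (𝓝 0) := by
    have := (Real.isLittleO_log_id_atTop.tendsto_div_nhds_zero.const_mul (|α| + 1)).add
      (tendsto_const_nhds (x := C).div_atTop tendsto_id)
    simpa using this
  refine squeeze_zero_norm' ?_ h1
  filter_upwards [eventually_ge_atTop a, eventually_ge_atTop 1] with t hat ht
  rw [norm_div, Real.norm_eq_abs, Real.norm_eq_abs, abs_of_pos (by linarith : 0 < t),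
    ← mul_div_assoc, ← add_div]
  gcongr
  exact hC t hat ht

end SlowVariation

/-! ### Growth and decay of the profile T. -/

namespace IsCuspProfile

variable {α A B a : ℝ} {L T : ℝ → ℝ}

lemma continuous (hT : IsCuspProfile α L A B a T) : Continuous T := hT.contDiff.continuous

/-- On `[a, ∞)` the cusp formula can be solved for L in terms of T, so L inherits its continuity. -/
lemma continuousOn_slowlyVarying (hT : IsCuspProfile α L A B a T) (hL : IsSlowlyVarying L) :
    ContinuousOn L (Set.Ici a) := by
  have h1 : ContinuousOn (fun t => Real.exp (-t) * t ^ α / T t) (Set.Ici a) := by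
    refine ContinuousOn.div ?_ hT.continuous.continuousOn fun t _ => (hT.pos t).ne'
    refine ContinuousOn.mul (by fun_prop) (continuousOn_id.rpow_const fun t ht => Or.inl ?_)
    exact (hT.a_pos.trans_le ht).ne'
  refine h1.congr fun t ht => ?_
  have h2 := hT.pos t
  have h3 := hL.pos t (hT.a_pos.le.trans ht)
  rw [eq_div_iff h2.ne', hT.eq_cusp t ht]
  field_simp

lemma log_eq (hT : IsCuspProfile α L A B a T) (hL : IsSlowlyVarying L) {t : ℝ} (ht : a ≤ t) :
    Real.log (T t) = -t + logWeight α L t := by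
  have h0 : 0 < t := hT.a_pos.trans_le ht
  have h1 : 0 < t ^ α := Real.rpow_pos_of_pos h0 α
  have h2 := hL.pos t h0.le
  rw [hT.eq_cusp t ht, Real.log_mul (Real.exp_pos _).ne' (div_pos h1 h2).ne', Real.log_exp,
    Real.log_div h1.ne' h2.ne', Real.log_rpow h0, logWeight]

lemma tendsto_log_div (hT : IsCuspProfile α L A B a T) (hL : IsSlowlyVarying L) :
    Tendsto (fun t => Real.log (T t) / t) atTop (𝓝 (-1)) := by
  have h := (hL.tendsto_logWeight_div hT.a_pos (hT.continuousOn_slowlyVarying hL) α).const_add (-1)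
  rw [add_zero] at h
  refine h.congr' ?_
  filter_upwards [eventually_ge_atTop a] with t ht
  have h0 : 0 < t := hT.a_pos.trans_le ht
  rw [hT.log_eq hL ht]
  field_simp

lemma tendsto_zero (hT : IsCuspProfile α L A B a T) (hL : IsSlowlyVarying L) :
    Tendsto T atTop (𝓝 0) := by
  have h1 : Tendsto (fun t => Real.log (T t)) atTop atBot := by
    have := (hT.tendsto_log_div hL).neg_mul_atTop (by norm_num : (-1 : ℝ) < 0) tendsto_id
    refine this.congr' ?_
    filter_upwards [eventually_gt_atTop 0] with t ht
    simp only [id_eq]; field_simp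
  exact (Real.tendsto_exp_atBot.comp h1).congr fun t => Real.exp_log (hT.pos t)

lemma exists_neg_log_le (hT : IsCuspProfile α L A B a T) (hL : IsSlowlyVarying L) {ε : ℝ}
    (hε : 0 < ε) : ∃ C, ∀ t, 0 ≤ t → -Real.log (T t) ≤ (1 + ε) * t + C := by
  have h1 : ∀ᶠ t in atTop, -1 - ε < Real.log (T t) / t :=
    (hT.tendsto_log_div hL).eventually_const_lt (by linarith)
  obtain ⟨X, hX⟩ := eventually_atTop.1 h1
  obtain ⟨C, hC⟩ := isCompact_Icc.exists_bound_of_continuousOn (s := Set.Icc (0 : ℝ) (max X 1))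
    (f := fun t => Real.log (T t)) (hT.continuous.log fun t => (hT.pos t).ne').continuousOn
  have hC0 : 0 ≤ C := (norm_nonneg _).trans (hC 0 ⟨le_rfl, by positivity⟩)
  refine ⟨C, fun t ht => ?_⟩
  rcases le_total t (max X 1) with h | h
  · have h2 := hC t ⟨ht, h⟩
    rw [Real.norm_eq_abs] at h2
    have := neg_abs_le (Real.log (T t))
    have : 0 ≤ (1 + ε) * t := by positivity
    linarith
  · have ht0 : 0 < t := lt_of_lt_of_le (by positivity) h
    have := hX t ((le_max_left _ _).trans h)
    rw [lt_div_iff₀ ht0] at this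
    linarith

lemma hasDerivAt (hT : IsCuspProfile α L A B a T) (t : ℝ) : HasDerivAt T (deriv T t) t :=
  (hT.contDiff.differentiable two_ne_zero t).hasDerivAt

lemma hasDerivAt_deriv (hT : IsCuspProfile α L A B a T) (t : ℝ) :
    HasDerivAt (deriv T) (deriv (deriv T) t) t := by
  have h : ContDiff ℝ (1 + 1) T := hT.contDiff.of_le (by norm_num)
  exact ((contDiff_succ_iff_deriv.1 h).2.2.differentiable one_ne_zero t).hasDerivAt

lemma deriv_nonpos (hT : IsCuspProfile α L A B a T) (t : ℝ) : deriv T t ≤ 0 :=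
  hT.strictAnti.antitone.deriv_nonpos

lemma mul_le_deriv_deriv (hT : IsCuspProfile α L A B a T) (t : ℝ) :
    A * T t ≤ deriv (deriv T) t := by
  have := hT.curvature_le t
  rw [neg_le_neg_iff, le_div_iff₀ (hT.pos t)] at this
  exact this

/-- The function T'² - A T² has derivative 2 T'(T'' - A T) ≤ 0, and it is bounded below by -A T²,
which tends to 0. A nonincreasing function with such a lower bound is nonnegative. -/
lemma mul_sq_le_deriv_sq (hT : IsCuspProfile α L A B a T) (hL : IsSlowlyVarying L) (t : ℝ) :
    A * T t ^ 2 ≤ deriv T t ^ 2 := by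
  have hd : ∀ t, HasDerivAt (fun t => deriv T t ^ 2 - A * T t ^ 2)
      (2 * deriv T t * (deriv (deriv T) t - A * T t)) t := fun t => by
    refine (((hT.hasDerivAt_deriv t).pow 2).sub (((hT.hasDerivAt t).pow 2).const_mul A)).congr_deriv
      ?_
    norm_num; ring
  have hanti : Antitone fun t => deriv T t ^ 2 - A * T t ^ 2 :=
    antitone_of_hasDerivAt_nonpos hd fun t => mul_nonpos_of_nonpos_of_nonneg
      (by have := hT.deriv_nonpos t; simp only; linarith)
      (sub_nonneg.2 (hT.mul_le_deriv_deriv t))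
  have hlim : Tendsto (fun s => -(A * T s ^ 2)) atTop (𝓝 0) := by
    simpa using (((hT.tendsto_zero hL).pow 2).const_mul A).neg
  have : 0 ≤ deriv T t ^ 2 - A * T t ^ 2 := by
    refine le_of_tendsto hlim ?_
    filter_upwards [eventually_ge_atTop t] with s hs
    have := hanti hs
    simp only at this
    linarith [sq_nonneg (deriv T s)]
  linarith

/-- Integrates T' ≤ -√A T. The decay is uniform in m, as dominated convergence for `heightDefect`
will require. -/
lemma le_mul_exp (hT : IsCuspProfile α L A B a T) (hL : IsSlowlyVarying L) (m : ℝ) {s : ℝ}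
    (hs : 0 ≤ s) : T m ≤ T (m - s) * Real.exp (-(Real.sqrt A * s)) := by
  have hle : ∀ t, deriv T t ≤ -(Real.sqrt A * T t) := fun t => by
    have h1 := Real.sqrt_le_sqrt (hT.mul_sq_le_deriv_sq hL t)
    rw [Real.sqrt_mul hT.A_pos.le, Real.sqrt_sq (hT.pos t).le, Real.sqrt_sq_eq_abs,
      abs_of_nonpos (hT.deriv_nonpos t)] at h1
    linarith
  have hd : ∀ t, HasDerivAt (fun t => T t * Real.exp (Real.sqrt A * t))
      ((deriv T t + Real.sqrt A * T t) * Real.exp (Real.sqrt A * t)) t := fun t => by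
    refine ((hT.hasDerivAt t).mul ((hasDerivAt_id t).const_mul (Real.sqrt A)).exp).congr_deriv ?_
    simp; ring
  have hanti := antitone_of_hasDerivAt_nonpos hd fun t => mul_nonpos_of_nonpos_of_nonneg
      (by have := hle t; simp only; linarith) (Real.exp_pos _).le
  have := hanti (sub_le_self m hs)
  simp only at this
  rw [← le_div_iff₀ (Real.exp_pos _), mul_div_assoc, ← Real.exp_sub] at this
  convert! this using 3
  ring

lemma tendsto_div_sub (hT : IsCuspProfile α L A B a T) (hL : IsSlowlyVarying L) (s : ℝ) :
    Tendsto (fun m => T m / T (m - s)) atTop (𝓝 (Real.exp (-s))) := by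
  have hsub : Tendsto (fun m : ℝ => m - s) atTop atTop := tendsto_atTop_add_const_right _ _ tendsto_id
  have hdiv : Tendsto (fun m : ℝ => m / (m - s)) atTop (𝓝 1) := by
    have := ((tendsto_const_nhds (x := s)).div_atTop hsub).const_add 1
    rw [add_zero] at this
    refine this.congr' ?_
    filter_upwards [hsub.eventually_gt_atTop 0] with m hm
    field_simp; ring
  have h1 := (hL.tendsto_logWeight_sub hT.a_pos (hT.continuousOn_slowlyVarying hL) α one_pos
    hsub hdiv).const_add (-s)
  rw [Real.log_one, mul_zero, add_zero] at h1
  refine ((Real.continuous_exp.tendsto _).comp h1).congr' ?_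
  filter_upwards [eventually_ge_atTop a, hsub.eventually_ge_atTop a] with m h2 h3
  rw [Function.comp_apply, ← Real.exp_log (div_pos (hT.pos m) (hT.pos (m - s))),
    Real.log_div (hT.pos _).ne' (hT.pos _).ne', hT.log_eq hL h2, hT.log_eq hL h3]
  ring_nf

end IsCuspProfile

/-! ### The height defect and its limit 1 - log 2. -/

section DefectIntegral

lemma one_sub_sqrt_nonneg (x : ℝ) : 0 ≤ 1 - Real.sqrt (1 - x ^ 2) := by
  rw [sub_nonneg, Real.sqrt_le_one]
  nlinarith

lemma one_sub_sqrt_le_sq {x : ℝ} (hx : x ^ 2 ≤ 1) : 1 - Real.sqrt (1 - x ^ 2) ≤ x ^ 2 := by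
  have : 1 - x ^ 2 ≤ Real.sqrt (1 - x ^ 2) := by
    refine Real.le_sqrt_of_sq_le ?_
    nlinarith [sq_nonneg x]
  linarith

lemma integral_one_sub_sqrt_one_sub_exp :
    ∫ s in Set.Ioi (0 : ℝ), (1 - Real.sqrt (1 - Real.exp (-s) ^ 2)) = 1 - Real.log 2 := by
  set q : ℝ → ℝ := fun s => Real.sqrt (1 - Real.exp (-s) ^ 2) with hq
  have hq0 : ∀ s, 0 ≤ q s := fun s => Real.sqrt_nonneg _
  have hqc : Continuous q := by rw [hq]; fun_prop
  -- Since q' = (1 - q²)/q, the primitive has derivative q' q/(1 + q) = 1 - q.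
  have hd : ∀ s ∈ Set.Ioi (0 : ℝ), HasDerivAt (fun s => q s - Real.log (1 + q s)) (1 - q s) s := by
    intro s hs
    have hlt : Real.exp (-s) < 1 := by simpa using hs
    have hpos : 0 < 1 - Real.exp (-s) ^ 2 := by nlinarith [Real.exp_pos (-s)]
    have hqp : 0 < q s := Real.sqrt_pos.2 hpos
    have hqs : q s ^ 2 = 1 - Real.exp (-s) ^ 2 := Real.sq_sqrt hpos.le
    have h1 : HasDerivAt q ((Real.exp (-s)) ^ 2 / q s) s := by
      have := (((hasDerivAt_neg s).exp.pow 2).const_sub 1).sqrt hpos.ne'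
      refine this.congr_deriv ?_
      change _ / (2 * q s) = _
      field_simp
      norm_num
      ring
    refine (h1.sub ((h1.const_add 1).log (by linarith))).congr_deriv ?_
    have : 1 + q s ≠ 0 := by linarith
    rw [show Real.exp (-s) ^ 2 = 1 - q s ^ 2 by linarith]
    field_simp
    ring
  have hlim : Tendsto (fun s => q s - Real.log (1 + q s)) atTop (𝓝 (1 - Real.log 2)) := by
    have h1 : Tendsto q atTop (𝓝 1) := by
      have h2 : Tendsto (fun s : ℝ => Real.exp (-s)) atTop (𝓝 0) := Real.tendsto_exp_neg_atTop_nhds_zero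
      have := (Real.continuous_sqrt.tendsto _).comp ((h2.pow 2).const_sub 1)
      convert! this using 2; norm_num
    have h3 := (Real.continuousAt_log (by norm_num : (1 + 1 : ℝ) ≠ 0)).tendsto.comp (h1.const_add 1)
    rw [show (1 + 1 : ℝ) = 2 by norm_num] at h3
    exact h1.sub h3
  have hc : ContinuousWithinAt (fun s => q s - Real.log (1 + q s)) (Set.Ici 0) 0 := by
    have : Continuous fun s => q s - Real.log (1 + q s) :=
      hqc.sub (Continuous.log (by fun_prop) fun s => by have := hq0 s; linarith)
    exact this.continuousWithinAt
  rw [MeasureTheory.integral_Ioi_of_hasDerivAt_of_nonneg hc hd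
    (fun s _ => one_sub_sqrt_nonneg _) hlim]
  simp [hq]

variable {α A B a : ℝ} {L T : ℝ → ℝ}

/-- The defect between the height `m` and the calibration `W(m)`, extended to `(0, ∞)`. -/
def heightDefect (T : ℝ → ℝ) (m : ℝ) : ℝ :=
  ∫ s in Set.Ioi (0 : ℝ), (1 - Real.sqrt (1 - (T m / T (m - s)) ^ 2))

lemma IsCuspProfile.defect_le (hT : IsCuspProfile α L A B a T) (hL : IsSlowlyVarying L) (m : ℝ)
    {s : ℝ} (hs : 0 ≤ s) : 1 - Real.sqrt (1 - (T m / T (m - s)) ^ 2) ≤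
      Real.exp (-(2 * Real.sqrt A) * s) := by
  have h1 : T m / T (m - s) ≤ Real.exp (-(Real.sqrt A * s)) := by
    rw [div_le_iff₀ (hT.pos _), mul_comm]
    exact hT.le_mul_exp hL m hs
  have h0 : 0 ≤ T m / T (m - s) := (div_pos (hT.pos _) (hT.pos _)).le
  have h2 : (T m / T (m - s)) ^ 2 ≤ Real.exp (-(2 * Real.sqrt A) * s) := by
    calc _ ≤ Real.exp (-(Real.sqrt A * s)) ^ 2 := by gcongr
      _ = _ := by rw [← Real.exp_nat_mul]; congr 1; push_cast; ring
  refine (one_sub_sqrt_le_sq (h2.trans ?_)).trans h2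
  rw [Real.exp_le_one_iff]
  have := mul_nonneg (Real.sqrt_nonneg A) hs
  linarith

lemma IsCuspProfile.continuous_defect (hT : IsCuspProfile α L A B a T) (m : ℝ) :
    Continuous fun s => 1 - Real.sqrt (1 - (T m / T (m - s)) ^ 2) := by
  have h1 := fun s => (hT.pos (m - s)).ne'
  have h2 := hT.continuous
  fun_prop (disch := assumption)

lemma IsCuspProfile.integrableOn_exp (hT : IsCuspProfile α L A B a T) :
    MeasureTheory.IntegrableOn (fun s => Real.exp (-(2 * Real.sqrt A) * s)) (Set.Ioi 0) :=
  exp_neg_integrableOn_Ioi 0 (by have := Real.sqrt_pos.2 hT.A_pos; linarith)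

lemma IsCuspProfile.integrableOn_defect (hT : IsCuspProfile α L A B a T)
    (hL : IsSlowlyVarying L) (m : ℝ) :
    MeasureTheory.IntegrableOn (fun s => 1 - Real.sqrt (1 - (T m / T (m - s)) ^ 2))
      (Set.Ioi 0) := by
  refine MeasureTheory.Integrable.mono' hT.integrableOn_exp
    (hT.continuous_defect m).aestronglyMeasurable ?_
  filter_upwards [MeasureTheory.ae_restrict_mem measurableSet_Ioi] with s hs
  rw [Real.norm_of_nonneg (one_sub_sqrt_nonneg _)]
  exact hT.defect_le hL m (le_of_lt hs)

/-- A bound uniform in m, needed before the heights of nearly minimizing curves are known to tend to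
infinity. -/
lemma IsCuspProfile.exists_heightDefect_le (hT : IsCuspProfile α L A B a T)
    (hL : IsSlowlyVarying L) : ∃ C, ∀ m, heightDefect T m ≤ C :=
  ⟨_, fun m => MeasureTheory.setIntegral_mono_on (hT.integrableOn_defect hL m)
    hT.integrableOn_exp measurableSet_Ioi fun _ hs => hT.defect_le hL m (le_of_lt hs)⟩

lemma IsCuspProfile.tendsto_heightDefect (hT : IsCuspProfile α L A B a T)
    (hL : IsSlowlyVarying L) : Tendsto (heightDefect T) atTop (𝓝 (1 - Real.log 2)) := by
  rw [← integral_one_sub_sqrt_one_sub_exp]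
  refine MeasureTheory.tendsto_integral_filter_of_dominated_convergence
    (fun s => Real.exp (-(2 * Real.sqrt A) * s)) ?_ ?_ hT.integrableOn_exp ?_
  · exact Eventually.of_forall fun m => (hT.continuous_defect m).aestronglyMeasurable
  · refine Eventually.of_forall fun m => ?_
    filter_upwards [MeasureTheory.ae_restrict_mem measurableSet_Ioi] with s hs
    rw [Real.norm_of_nonneg (one_sub_sqrt_nonneg _)]
    exact hT.defect_le hL m (le_of_lt hs)
  · refine Eventually.of_forall fun s => ?_
    exact ((Real.continuous_sqrt.tendsto _).comp
      (((hT.tendsto_div_sub hL s).pow 2).const_sub 1)).const_sub 1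

/-- The integrand of the defect is nonnegative, so cutting it at s = m, that is at height 0, only
decreases it; then substitute t = m - s. -/
lemma IsCuspProfile.sub_heightDefect_le (hT : IsCuspProfile α L A B a T)
    (hL : IsSlowlyVarying L) {m : ℝ} (hm : 0 ≤ m) :
    m - heightDefect T m ≤ ∫ t in (0 : ℝ)..m, Real.sqrt (1 - (T m / T t) ^ 2) := by
  have hc := hT.continuous_defect m
  have h1 : ∫ s in (0 : ℝ)..m, (1 - Real.sqrt (1 - (T m / T (m - s)) ^ 2)) ≤ heightDefect T m := by
    rw [intervalIntegral.integral_of_le hm]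
    exact MeasureTheory.setIntegral_mono_set (hT.integrableOn_defect hL m)
      (Eventually.of_forall fun s => one_sub_sqrt_nonneg _)
      (Set.Ioc_subset_Ioi_self).eventuallyLE
  have hc2 : Continuous fun s => Real.sqrt (1 - (T m / T (m - s)) ^ 2) := by
    simpa [Pi.sub_def] using (continuous_const (y := (1 : ℝ))).sub hc
  rw [intervalIntegral.integral_sub (by simp) (hc2.intervalIntegrable _ _),
    intervalIntegral.integral_comp_sub_left (fun t => Real.sqrt (1 - (T m / T t) ^ 2))] at h1
  simp only [intervalIntegral.integral_const, sub_self, sub_zero, smul_eq_mul, mul_one] at h1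
  linarith

end DefectIntegral

/-! ### Two-sided asymptotics of d(o, (x, 0)). -/

section DistanceAsymptotics

variable {α A B a : ℝ} {L T : ℝ → ℝ}

/-- The curve (r tanh u, log r - log cosh u) is a unit-speed geodesic of e^{-2t} dx² + dt².
Stretching it horizontally by coth u₀ makes its ends at u = ±u₀ lie exactly above 0 and x. The
constant K measures the deviation of T from the hyperbolic profile. -/
lemma warpedSpeed_arc_le {x h u₀ K u : ℝ} (hT : ∀ t, 0 < T t) (hK : 1 ≤ K) (hu₀ : 0 < u₀)
    (hbd : T (h - Real.log (Real.cosh u)) * (|x| / 2) ≤ K * Real.cosh u) :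
    warpedSpeed T (fun u => x / 2 * (1 + Real.sinh u / Real.cosh u * (Real.cosh u₀ / Real.sinh u₀)))
      (fun u => h - Real.log (Real.cosh u)) u ≤ K * (Real.cosh u₀ / Real.sinh u₀) := by
  have hc := Real.cosh_pos u
  have hs₀ := Real.sinh_pos_iff.2 hu₀
  set k := Real.cosh u₀ / Real.sinh u₀ with hk
  have hk1 : 1 ≤ k := by
    rw [hk, one_le_div hs₀]; exact (Real.sinh_lt_cosh u₀).le
  have hd1 : HasDerivAt (fun u => x / 2 * (1 + Real.sinh u / Real.cosh u * k))
      (x / 2 * (k / Real.cosh u ^ 2)) u := by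
    refine ((((((Real.hasDerivAt_sinh u).div (Real.hasDerivAt_cosh u) hc.ne').mul_const k)).const_add
      1).const_mul (x / 2)).congr_deriv ?_
    have := Real.cosh_sq u
    rw [show Real.cosh u * Real.cosh u - Real.sinh u * Real.sinh u = 1 by linarith]
    ring
  have hd2 : HasDerivAt (fun u => h - Real.log (Real.cosh u)) (-(Real.sinh u / Real.cosh u)) u :=
    ((Real.hasDerivAt_cosh u).log hc.ne').const_sub h
  rw [warpedSpeed, hd1.deriv, hd2.deriv]
  refine Real.sqrt_le_iff.2 ⟨by positivity, ?_⟩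
  set τ := T (h - Real.log (Real.cosh u)) with hτ
  have hτ0 : 0 < τ := hT _
  have h1 : τ ^ 2 * (x / 2) ^ 2 ≤ K ^ 2 * Real.cosh u ^ 2 := by
    calc τ ^ 2 * (x / 2) ^ 2 = (τ * (|x| / 2)) ^ 2 := by rw [mul_pow, div_pow, div_pow, sq_abs]
      _ ≤ (K * Real.cosh u) ^ 2 := by gcongr
      _ = _ := by ring
  have h2 : Real.cosh u ^ 2 = Real.sinh u ^ 2 + 1 := Real.cosh_sq u
  have hKk : 1 ≤ K ^ 2 * k ^ 2 := by
    rw [← mul_pow]; exact one_le_pow₀ (one_le_mul_of_one_le_of_one_le hK hk1)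
  calc τ ^ 2 * (x / 2 * (k / Real.cosh u ^ 2)) ^ 2 + (-(Real.sinh u / Real.cosh u)) ^ 2
      = τ ^ 2 * (x / 2) ^ 2 * (k ^ 2 / Real.cosh u ^ 4) + Real.sinh u ^ 2 / Real.cosh u ^ 2 := by
        ring
    _ ≤ K ^ 2 * Real.cosh u ^ 2 * (k ^ 2 / Real.cosh u ^ 4) +
        K ^ 2 * k ^ 2 * (Real.sinh u ^ 2 / Real.cosh u ^ 2) := by
        gcongr
        exact le_mul_of_one_le_left (by positivity) hKk
    _ = K ^ 2 * k ^ 2 * ((1 + Real.sinh u ^ 2) / Real.cosh u ^ 2) := by field_simp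
    _ = (K * k) ^ 2 := by
        rw [h2, add_comm 1, div_self (by positivity)]; ring

lemma warpedDist_le_of_arc {x h u₀ K : ℝ} (hT : ∀ t, 0 < T t) (hK : 1 ≤ K) (hu₀ : 0 < u₀)
    (hh : Real.log (Real.cosh u₀) ≤ h)
    (hbd : ∀ v ∈ Set.Icc 0 (Real.log (Real.cosh u₀)), T (h - v) * (|x| / 2) ≤ K * Real.exp v) :
    warpedDist T (0, 0) (x, 0) ≤
      2 * (h - Real.log (Real.cosh u₀)) + K * (Real.cosh u₀ / Real.sinh u₀) * (2 * u₀) := by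
  have hs₀ := Real.sinh_pos_iff.2 hu₀
  have hg : ContDiff ℝ 1
      (fun u => x / 2 * (1 + Real.sinh u / Real.cosh u * (Real.cosh u₀ / Real.sinh u₀))) :=
    contDiff_const.mul (contDiff_const.add ((Real.contDiff_sinh.div Real.contDiff_cosh
      fun u => (Real.cosh_pos u).ne').mul contDiff_const))
  have hf : ContDiff ℝ 1 (fun u => h - Real.log (Real.cosh u)) :=
    contDiff_const.sub (Real.contDiff_cosh.log fun u => (Real.cosh_pos u).ne')
  have harc := warpedDist_le_of_speed_le (T := T) hg hf (a := -u₀) (b := u₀) (by linarith)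
    (fun u hu => warpedSpeed_arc_le hT hK hu₀ (x := x) (h := h) (by
      have := hbd (Real.log (Real.cosh u)) ⟨Real.log_nonneg (Real.one_le_cosh u),
        Real.log_le_log (Real.cosh_pos u) (Real.cosh_le_cosh.2 (by
          rw [abs_of_pos hu₀]; exact abs_le.2 hu))⟩
      rwa [Real.exp_log (Real.cosh_pos u)] at this))
  have hc := Real.cosh_pos u₀
  have e1 : x / 2 * (1 + Real.sinh (-u₀) / Real.cosh (-u₀) * (Real.cosh u₀ / Real.sinh u₀)) = 0 := by
    rw [Real.sinh_neg, Real.cosh_neg]; field_simp; ring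
  have e2 : x / 2 * (1 + Real.sinh u₀ / Real.cosh u₀ * (Real.cosh u₀ / Real.sinh u₀)) = x := by
    field_simp; ring
  rw [e1, e2, Real.cosh_neg] at harc
  set H := h - Real.log (Real.cosh u₀) with hH
  have hv1 := warpedDist_vertical_le (T := T) 0 0 H
  have hv2 := warpedDist_vertical_le (T := T) x H 0
  have t1 := warpedDist_triangle hT (0, 0) (0, H) (x, 0)
  have t2 := warpedDist_triangle hT (0, H) (x, H) (x, 0)
  have hH0 : 0 ≤ H := sub_nonneg.2 hh
  rw [zero_sub, abs_neg, abs_of_nonneg hH0] at hv1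
  rw [sub_zero, abs_of_nonneg hH0] at hv2
  have : K * (Real.cosh u₀ / Real.sinh u₀) * (u₀ - -u₀) =
    K * (Real.cosh u₀ / Real.sinh u₀) * (2 * u₀) := by ring
  linarith

/-- Half of the asymptotic value of `d(o, (x, 0))`. -/
def halfDist (α : ℝ) (L : ℝ → ℝ) (x : ℝ) : ℝ := Real.log x + logWeight α L (Real.log x)

variable {ι : Type*} {l : Filter ι} {x : ι → ℝ}

lemma IsCuspProfile.tendsto_halfDist_div (hT : IsCuspProfile α L A B a T) (hL : IsSlowlyVarying L)
    (hx : Tendsto x l atTop) :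
    Tendsto (fun i => halfDist α L (x i) / Real.log (x i)) l (𝓝 1) := by
  have hz := Real.tendsto_log_atTop.comp hx
  have h := ((hL.tendsto_logWeight_div hT.a_pos
    (hT.continuousOn_slowlyVarying hL) α).comp hz).const_add 1
  rw [add_zero] at h
  refine h.congr' ?_
  filter_upwards [hz.eventually_gt_atTop 0] with i hi
  simp only [Function.comp_apply, halfDist] at hi ⊢
  field_simp

lemma IsCuspProfile.eventually_warpedDist_le_arc (hT : IsCuspProfile α L A B a T)
    (hL : IsSlowlyVarying L) (hx : Tendsto (fun i => |x i|) l atTop) {u₀ ε : ℝ} (hu₀ : 0 < u₀)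
    (hε : 0 < ε) :
    ∀ᶠ i in l, warpedDist T (0, 0) (x i, 0) ≤
      2 * (halfDist α L |x i| - Real.log 2 - Real.log (Real.cosh u₀)) +
        (1 + ε) * (Real.cosh u₀ / Real.sinh u₀) * (2 * u₀) := by
  set V := Real.log (Real.cosh u₀) with hV
  set z : ι → ℝ := fun i => Real.log |x i| with hzdef
  have hz : Tendsto z l atTop := Real.tendsto_log_atTop.comp hx
  set h : ι → ℝ := fun i => halfDist α L |x i| - Real.log 2 with hh
  have hhz : Tendsto (fun i => h i / z i) l (𝓝 1) := by
    have := (hT.tendsto_halfDist_div hL hx).sub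
      ((tendsto_const_nhds (x := Real.log 2)).div_atTop hz)
    rw [sub_zero] at this
    exact this.congr fun i => by rw [hh, sub_div]
  have hh_top : Tendsto h l atTop := by
    refine (Tendsto.pos_mul_atTop one_pos hhz hz).congr' ?_
    filter_upwards [hz.eventually_gt_atTop 0] with i hi
    field_simp
  -- Convergence along the product with a principal filter encodes uniformity over the depths v in
  -- `[0, V]` below the apex.
  have hfst : Tendsto (Prod.fst : ι × ℝ → ι) (l ×ˢ 𝓟 (Set.Icc 0 V)) l := tendsto_fst
  have hvz : Tendsto (fun p : ι × ℝ => p.2 / z p.1) (l ×ˢ 𝓟 (Set.Icc 0 V)) (𝓝 0) := by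
    refine squeeze_zero_norm' ?_
      (((tendsto_const_nhds (x := V)).div_atTop hz).comp hfst)
    have e1 : ∀ᶠ p : ι × ℝ in l ×ˢ 𝓟 (Set.Icc 0 V), p.2 ∈ Set.Icc 0 V :=
      tendsto_snd.eventually (mem_principal_self _)
    filter_upwards [e1, hfst.eventually (hz.eventually_gt_atTop 0)] with p h1 h2
    rw [norm_div, Real.norm_of_nonneg h1.1, Real.norm_of_nonneg h2.le]
    exact div_le_div_of_nonneg_right h1.2 h2.le
  have hratio : Tendsto (fun p : ι × ℝ => (h p.1 - p.2) / z p.1) (l ×ˢ 𝓟 (Set.Icc 0 V)) (𝓝 1) := by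
    have := (hhz.comp hfst).sub hvz
    rw [sub_zero] at this
    exact this.congr fun p => (sub_div _ _ _).symm
  have hw := hL.tendsto_logWeight_sub hT.a_pos (hT.continuousOn_slowlyVarying hL) α one_pos
    (hz.comp hfst) hratio
  rw [Real.log_one, mul_zero] at hw
  have hev := hw.eventually_lt_const (Real.log_pos (by linarith : 1 < 1 + ε))
  rw [eventually_prod_principal_iff] at hev
  filter_upwards [hev, hh_top.eventually_ge_atTop (V + a), hx.eventually_gt_atTop 0] with i h1 h2 h3
  refine warpedDist_le_of_arc hT.pos (by linarith) hu₀ (by linarith [hT.a_pos]) fun v hv => ?_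
  have h4 := h1 v hv
  have h5 : a ≤ h i - v := by linarith [hv.2]
  have h6 := hT.log_eq hL h5
  have h7 : 0 < |x i| / 2 := by positivity
  change T (h i - v) * (|x i| / 2) ≤ _
  rw [← Real.log_le_log_iff (mul_pos (hT.pos _) h7) (by positivity),
    Real.log_mul (hT.pos _).ne' h7.ne', h6, Real.log_mul (by positivity) (Real.exp_pos _).ne',
    Real.log_exp, Real.log_div h3.ne' two_ne_zero]
  simp only [Function.comp_apply, hh, hzdef, halfDist] at h4 ⊢
  linarith

lemma IsCuspProfile.eventually_warpedDist_le (hT : IsCuspProfile α L A B a T)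
    (hL : IsSlowlyVarying L) (hx : Tendsto (fun i => |x i|) l atTop) {η : ℝ} (hη : 0 < η) :
    ∀ᶠ i in l, warpedDist T (0, 0) (x i, 0) ≤ 2 * halfDist α L |x i| + η := by
  -- Half of η pays for the finite arc, through u₀ coth u₀ ≤ u₀ + e^{-u₀}; the other half pays for
  -- the factor 1 + ε, with ε = η / (4 cosh u₀).
  obtain ⟨u₀, hu₀, hexp⟩ : ∃ u₀ : ℝ, 0 < u₀ ∧ Real.exp (-u₀) < η / 4 :=
    ((eventually_gt_atTop 0).and (Real.tendsto_exp_neg_atTop_nhds_zero.eventually_lt_const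
      (by positivity))).exists
  have hc := Real.cosh_pos u₀
  have hs := Real.sinh_pos_iff.2 hu₀
  filter_upwards [hT.eventually_warpedDist_le_arc hL hx hu₀
    (ε := η / (4 * Real.cosh u₀)) (by positivity)] with i hi
  refine hi.trans ?_
  have h1 : u₀ - Real.log 2 ≤ Real.log (Real.cosh u₀) := by
    rw [← Real.log_exp u₀, ← Real.log_div (Real.exp_pos _).ne' two_ne_zero, Real.log_exp]
    refine Real.log_le_log (by positivity) ?_
    rw [Real.cosh_eq]
    have := Real.exp_pos (-u₀)
    linarith
  have h2 : u₀ ≤ Real.sinh u₀ := Real.self_le_sinh_iff.2 hu₀.le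
  have h3 : Real.cosh u₀ / Real.sinh u₀ * u₀ = u₀ + Real.exp (-u₀) * (u₀ / Real.sinh u₀) := by
    have : Real.cosh u₀ = Real.sinh u₀ + Real.exp (-u₀) := by
      rw [← Real.cosh_sub_sinh]; ring
    rw [this]; field_simp
  have h4 : u₀ / Real.sinh u₀ ≤ 1 := (div_le_one hs).2 h2
  have h5 : Real.exp (-u₀) * (u₀ / Real.sinh u₀) ≤ η / 4 :=
    (mul_le_of_le_one_right (Real.exp_pos _).le h4).trans hexp.le
  have h6 : η / (4 * Real.cosh u₀) * (Real.cosh u₀ / Real.sinh u₀ * u₀) ≤ η / 4 := by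
    have : η / (4 * Real.cosh u₀) * (Real.cosh u₀ / Real.sinh u₀ * u₀) =
      η / 4 * (u₀ / Real.sinh u₀) := by field_simp
    rw [this]
    exact mul_le_of_le_one_right (by positivity) h4
  have h7 : (1 + η / (4 * Real.cosh u₀)) * (Real.cosh u₀ / Real.sinh u₀) * (2 * u₀) =
      2 * (Real.cosh u₀ / Real.sinh u₀ * u₀) +
        2 * (η / (4 * Real.cosh u₀) * (Real.cosh u₀ / Real.sinh u₀ * u₀)) := by ring
  rw [h7]
  linarith

lemma IsCuspProfile.eventually_le_warpedDist (hT : IsCuspProfile α L A B a T)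
    (hL : IsSlowlyVarying L) (hx : Tendsto (fun i => |x i|) l atTop) {η : ℝ} (hη : 0 < η) :
    ∀ᶠ i in l, 2 * halfDist α L |x i| - η ≤ warpedDist T (0, 0) (x i, 0) := by
  choose m hm0 hm using fun i =>
    exists_height_lt_warpedDist_add hT.continuous hT.pos hT.strictAnti (x i) (half_pos hη)
  obtain ⟨C, hC⟩ := hT.exists_heightDefect_le hL
  have hm' : ∀ i, T (m i) * |x i| + 2 * (m i - heightDefect T (m i)) <
      warpedDist T (0, 0) (x i, 0) + η / 2 := fun i =>
    lt_of_le_of_lt (by linarith [hT.sub_heightDefect_le hL (hm0 i)]) (hm i)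
  set z : ι → ℝ := fun i => Real.log |x i| with hzdef
  have hz : Tendsto z l atTop := Real.tendsto_log_atTop.comp hx
  have hFz : Tendsto (fun i => halfDist α L |x i| / z i) l (𝓝 1) := hT.tendsto_halfDist_div hL hx
  have hcz : ∀ c : ℝ, Tendsto (fun i => c / z i) l (𝓝 0) := fun c =>
    (tendsto_const_nhds (x := c)).div_atTop hz
  have hup := hT.eventually_warpedDist_le hL hx one_pos
  -- The upper bound on the distance controls both terms: T(m)|x| = O(log|x|) prevents m from being
  -- too small, and 2 m ≤ d + O(1) from being too large. The slope 1 + (1 - b)/2 is close enough to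
  -- 1 that its product with b < 1 stays below 1.
  have hmz : Tendsto (fun i => m i / z i) l (𝓝 1) := by
    refine tendsto_order.2 ⟨fun b hb => ?_, fun b hb => ?_⟩
    · obtain ⟨C', hC'⟩ := hT.exists_neg_log_le hL (ε := (1 - b) / 2) (by linarith)
      have hlog : Tendsto (fun i => Real.log (3 * z i) / z i) l (𝓝 0) := by
        have h1 := (Real.isLittleO_log_id_atTop.tendsto_div_nhds_zero.comp
          (hz.const_mul_atTop (by norm_num : (0 : ℝ) < 3))).const_mul 3
        rw [mul_zero] at h1
        refine h1.congr fun i => ?_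
        simp only [Function.comp_apply, id_eq]
        rw [mul_div_assoc', mul_div_mul_left _ _ three_ne_zero]
      have hlim : Tendsto (fun i => 1 - Real.log (3 * z i) / z i - C' / z i) l (𝓝 1) := by
        simpa using (hlog.const_sub 1).sub (hcz C')
      have hF3 : Tendsto (fun i => 2 * (halfDist α L |x i| / z i) + (1 + η / 2 + 2 * C) / z i) l
          (𝓝 2) := by
        simpa using (hFz.const_mul 2).add (hcz (1 + η / 2 + 2 * C))
      have hb' : (1 + (1 - b) / 2) * b < 1 := by nlinarith
      filter_upwards [hup, hlim.eventually_const_lt hb', hz.eventually_gt_atTop 0,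
        hF3.eventually_lt_const (by norm_num : (2 : ℝ) < 3), hx.eventually_gt_atTop 0]
        with i h1 h2 h3 h4 h5
      rw [← mul_div_assoc, ← add_div, div_lt_iff₀ h3] at h4
      have h6 : T (m i) * |x i| ≤ 3 * z i := by
        linarith [hm' i, hC (m i), hm0 i]
      have h7 := Real.log_le_log (mul_pos (hT.pos _) h5) h6
      rw [Real.log_mul (hT.pos _).ne' h5.ne'] at h7
      have h8 := hC' (m i) (hm0 i)
      have h9 : (1 - Real.log (3 * z i) / z i - C' / z i) * z i ≤ (1 + (1 - b) / 2) * m i := by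
        have : (1 - Real.log (3 * z i) / z i - C' / z i) * z i = z i - Real.log (3 * z i) - C' := by
          field_simp
        rw [this]
        simp only [hzdef] at h7 ⊢
        linarith
      have h10 : (1 + (1 - b) / 2) * b * z i < (1 + (1 - b) / 2) * m i :=
        lt_of_lt_of_le (mul_lt_mul_of_pos_right h2 h3) h9
      rw [lt_div_iff₀ h3]
      rw [mul_assoc] at h10
      exact lt_of_mul_lt_mul_left h10 (by linarith)
    · have hlim : Tendsto (fun i => halfDist α L |x i| / z i + (1 / 2 + η / 4 + C) / z i) l
          (𝓝 1) := by
        simpa using hFz.add (hcz (1 / 2 + η / 4 + C))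
      filter_upwards [hup, hlim.eventually_lt_const hb, hz.eventually_gt_atTop 0] with i h1 h2 h3
      refine lt_of_le_of_lt ?_ h2
      rw [← add_div]
      refine div_le_div_of_nonneg_right ?_ h3.le
      have := mul_nonneg (hT.pos (m i)).le (abs_nonneg (x i))
      linarith [hm' i, hC (m i)]
  have hm_top : Tendsto m l atTop := by
    refine (Tendsto.pos_mul_atTop one_pos hmz hz).congr' ?_
    filter_upwards [hz.eventually_gt_atTop 0] with i hi
    field_simp
  have hw := hL.tendsto_logWeight_sub hT.a_pos (hT.continuousOn_slowlyVarying hL) α one_pos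
    hz hmz
  rw [Real.log_one, mul_zero] at hw
  have hJ := (hT.tendsto_heightDefect hL).comp hm_top
  have hlim : Tendsto (fun i => 2 * (logWeight α L (m i) - logWeight α L (z i)) +
      2 * (1 - Real.log 2 - heightDefect T (m i))) l (𝓝 0) := by
    simpa using (hw.const_mul 2).add ((hJ.const_sub (1 - Real.log 2)).const_mul 2)
  filter_upwards [hlim.eventually_const_lt (by linarith : -(η / 2) < 0),
    hm_top.eventually_ge_atTop a, hx.eventually_gt_atTop 0] with i h1 h2 h3
  -- Equality in 1 + log y ≤ y holds at y = 1, which is the condition defining the asymptotic apex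
  -- height; so nothing is lost to leading order.
  have h4 : Real.log (T (m i) * |x i| / 2) + 1 ≤ T (m i) * |x i| / 2 := by
    have := Real.add_one_le_exp (Real.log (T (m i) * |x i| / 2))
    rwa [Real.exp_log (by have := hT.pos (m i); positivity)] at this
  rw [Real.log_div (mul_pos (hT.pos _) h3).ne' two_ne_zero,
    Real.log_mul (hT.pos _).ne' h3.ne', hT.log_eq hL h2] at h4
  have := hm' i
  simp only [halfDist, hzdef] at h1 ⊢
  linarith

/-- The distance from `o` to `(x, 0)` is `2 (log |x| + α log log |x| - log L(log |x|)) + o(1)`. -/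
theorem IsCuspProfile.tendsto_warpedDist_sub (hT : IsCuspProfile α L A B a T)
    (hL : IsSlowlyVarying L) (hx : Tendsto (fun i => |x i|) l atTop) :
    Tendsto (fun i => warpedDist T (0, 0) (x i, 0) - 2 * halfDist α L |x i|) l (𝓝 0) := by
  rw [Metric.tendsto_nhds]
  intro ε hε
  filter_upwards [hT.eventually_warpedDist_le hL hx (half_pos hε),
    hT.eventually_le_warpedDist hL hx (half_pos hε)] with i h1 h2
  rw [Real.dist_eq, sub_zero, abs_lt]
  constructor <;> linarith

end DistanceAsymptotics

/-! ### Sums over the windows R ≤ d n < R + Δ. -/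

section LogarithmicWindows

lemma sum_Ioc_inv_eq_harmonic_sub {M N : ℕ} (h : M ≤ N) :
    ∑ n ∈ Finset.Ioc M N, ((n : ℝ))⁻¹ = (harmonic N : ℝ) - harmonic M := by
  induction N, h using Nat.le_induction with
  | base => simp
  | succ N h ih =>
    rw [← Finset.insert_Ioc_right_eq_Ioc_add_one (by omega), Finset.sum_insert (by simp), ih,
      harmonic_succ]
    push_cast
    ring

/-- The sum of `1 / n` over the integers with `u < log n ≤ v`. -/
def sumInvLog (u v : ℝ) : ℝ := ∑ n ∈ Finset.Ioc ⌊Real.exp u⌋₊ ⌊Real.exp v⌋₊, ((n : ℝ))⁻¹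

lemma mem_Ioc_floor_exp_iff {n : ℕ} {u v : ℝ} :
    n ∈ Finset.Ioc ⌊Real.exp u⌋₊ ⌊Real.exp v⌋₊ ↔ 1 ≤ n ∧ u < Real.log n ∧ Real.log n ≤ v := by
  rw [Finset.mem_Ioc, Nat.floor_lt (Real.exp_pos u).le, Nat.le_floor_iff (Real.exp_pos v).le]
  constructor
  · rintro ⟨h1, h2⟩
    have h0 : (0 : ℝ) < n := (Real.exp_pos u).trans h1
    exact ⟨by exact_mod_cast h0, (Real.lt_log_iff_exp_lt h0).2 h1, (Real.log_le_iff_le_exp h0).2 h2⟩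
  · rintro ⟨h0, h1, h2⟩
    have h0 : (0 : ℝ) < n := by exact_mod_cast h0
    exact ⟨(Real.lt_log_iff_exp_lt h0).1 h1, (Real.log_le_iff_le_exp h0).1 h2⟩

lemma tendsto_harmonic_floor_exp_sub :
    Tendsto (fun v : ℝ => (harmonic ⌊Real.exp v⌋₊ : ℝ) - v) atTop
      (𝓝 Real.eulerMascheroniConstant) := by
  have h1 := Real.tendsto_harmonic_sub_log.comp
    (tendsto_nat_floor_atTop.comp Real.tendsto_exp_atTop)
  have h2 := (Real.continuousAt_log one_ne_zero).tendsto.comp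
    ((tendsto_nat_floor_div_atTop (R := ℝ)).comp Real.tendsto_exp_atTop)
  rw [Real.log_one] at h2
  have h3 := h1.add h2
  rw [add_zero] at h3
  refine h3.congr' ?_
  filter_upwards [eventually_ge_atTop 0] with v hv
  have h4 : (0 : ℝ) < ⌊Real.exp v⌋₊ := by
    exact_mod_cast Nat.floor_pos.2 (Real.one_le_exp hv)
  simp only [Function.comp_apply]
  rw [Real.log_div h4.ne' (Real.exp_pos v).ne', Real.log_exp]
  ring

/-- The sum is a difference of harmonic numbers, each equal to its logarithmic endpoint plus Euler's
constant plus o(1). -/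
lemma tendsto_sumInvLog {ι : Type*} {l : Filter ι} {ρ : ι → ℝ} (hρ : Tendsto ρ l atTop) {s t : ℝ}
    (hst : s ≤ t) : Tendsto (fun i => sumInvLog (ρ i + s) (ρ i + t)) l (𝓝 (t - s)) := by
  have h1 := tendsto_harmonic_floor_exp_sub.comp (tendsto_atTop_add_const_right _ t hρ)
  have h2 := tendsto_harmonic_floor_exp_sub.comp (tendsto_atTop_add_const_right _ s hρ)
  have h3 := (h1.sub h2).add_const (t - s)
  rw [sub_self, zero_add] at h3
  refine h3.congr fun i => ?_
  rw [sumInvLog, sum_Ioc_inv_eq_harmonic_sub (Nat.floor_mono (Real.exp_le_exp.2 (by linarith)))]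
  simp only [Function.comp_apply]
  ring

/-- The sum of `e^{-d n / 2}` over the `n ≥ 1` with `R ≤ d n < R + Δ`. -/
def windowSum (d : ℕ → ℝ) (Δ R : ℝ) : ℝ :=
  ∑' n : ℕ, Set.indicator {n | 1 ≤ n ∧ R ≤ d n ∧ d n < R + Δ} (fun n => Real.exp (-(1 / 2) * d n)) n

variable {α a : ℝ} {L : ℝ → ℝ} {d : ℕ → ℝ}

/-- The value of `log n` at which `2 halfDist α L n` is close to `R`. -/
def logRadius (α : ℝ) (L : ℝ → ℝ) (R : ℝ) : ℝ := R / 2 - logWeight α L R + α * Real.log 2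

lemma tendsto_half_sub_log_add_logRadius (hL : IsSlowlyVarying L) (ha : 0 < a)
    (hc : ContinuousOn L (Set.Ici a)) (hd : Tendsto (fun n : ℕ => d n - 2 * halfDist α L n) atTop (𝓝 0))
    {ι : Type*} {l : Filter ι} {R : ι → ℝ} {n : ι → ℕ} (hR : Tendsto R l atTop)
    (hn : Tendsto n l atTop) (hnR : Tendsto (fun i => Real.log (n i) / R i) l (𝓝 (1 / 2))) :
    Tendsto (fun i => d (n i) / 2 - Real.log (n i) + (logRadius α L (R i) - R i / 2)) l (𝓝 0) := by
  have h1 := hL.tendsto_logWeight_sub ha hc α (by norm_num : (0 : ℝ) < 1 / 2) hR hnR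
  rw [one_div, Real.log_inv] at h1
  have h2 := (((hd.comp hn).div_const 2).add h1).add_const (α * Real.log 2)
  rw [show (0 : ℝ) / 2 + α * -Real.log 2 + α * Real.log 2 = 0 by ring] at h2
  refine h2.congr fun i => ?_
  simp only [Function.comp_apply, halfDist, logRadius]
  ring

lemma tendsto_logRadius_div (hL : IsSlowlyVarying L) (ha : 0 < a)
    (hc : ContinuousOn L (Set.Ici a)) (α : ℝ) :
    Tendsto (fun R => logRadius α L R / R) atTop (𝓝 (1 / 2)) := by
  have h := ((hL.tendsto_logWeight_div ha hc α).const_sub (1 / 2)).add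
    ((tendsto_const_nhds (x := α * Real.log 2)).div_atTop tendsto_id)
  rw [sub_zero, add_zero] at h
  refine h.congr' ?_
  filter_upwards [eventually_gt_atTop 0] with R hR
  simp only [id_eq, logRadius]
  field_simp

lemma tendsto_logRadius (hL : IsSlowlyVarying L) (ha : 0 < a)
    (hc : ContinuousOn L (Set.Ici a)) (α : ℝ) : Tendsto (logRadius α L) atTop atTop := by
  refine (Tendsto.pos_mul_atTop (by norm_num) (tendsto_logRadius_div hL ha hc α)
    tendsto_id).congr' ?_
  filter_upwards [eventually_gt_atTop 0] with R hR
  simp only [id_eq]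
  field_simp

lemma tendsto_div_log (hL : IsSlowlyVarying L) (ha : 0 < a)
    (hc : ContinuousOn L (Set.Ici a))
    (hd : Tendsto (fun n : ℕ => d n - 2 * halfDist α L n) atTop (𝓝 0)) :
    Tendsto (fun n : ℕ => d n / Real.log n) atTop (𝓝 2) := by
  have hz := Real.tendsto_log_atTop.comp (tendsto_natCast_atTop_atTop (R := ℝ))
  have h := (((hL.tendsto_logWeight_div ha hc α).comp hz).const_add 1).const_mul 2
  have h' := h.add (hd.div_atTop hz)
  rw [add_zero, add_zero, mul_one] at h'
  refine h'.congr' ?_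
  filter_upwards [hz.eventually_gt_atTop 0] with n hn
  simp only [Function.comp_apply, halfDist] at hn ⊢
  field_simp
  ring

lemma tendsto_atTop_of_sub_halfDist (hL : IsSlowlyVarying L) (ha : 0 < a)
    (hc : ContinuousOn L (Set.Ici a))
    (hd : Tendsto (fun n : ℕ => d n - 2 * halfDist α L n) atTop (𝓝 0)) :
    Tendsto d atTop atTop := by
  have hz := Real.tendsto_log_atTop.comp (tendsto_natCast_atTop_atTop (R := ℝ))
  refine (Tendsto.pos_mul_atTop two_pos (tendsto_div_log hL ha hc hd) hz).congr' ?_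
  filter_upwards [hz.eventually_gt_atTop 0] with n hn
  simp only [Function.comp_apply] at hn ⊢
  field_simp

/-- Confines the window to log n within η of [ρ, ρ + Δ/2], where ρ = `logRadius α L R`;
`eventually_abs_lt_of_log_mem` serves the reverse inclusion. -/
lemma eventually_abs_lt_of_mem_window (hL : IsSlowlyVarying L) (ha : 0 < a)
    (hc : ContinuousOn L (Set.Ici a))
    (hd : Tendsto (fun n : ℕ => d n - 2 * halfDist α L n) atTop (𝓝 0)) {Δ η : ℝ} (hη : 0 < η) :
    ∀ᶠ R in atTop, ∀ n : ℕ, R ≤ d n → d n < R + Δ →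
      |d n / 2 - Real.log n + (logRadius α L R - R / 2)| < η := by
  -- A limit along pairs (R, n) with R → ∞ and n in the window of R is exactly a limit uniform in n.
  set l : Filter (ℝ × ℕ) := comap Prod.fst atTop ⊓ 𝓟 {p | p.1 ≤ d p.2 ∧ d p.2 < p.1 + Δ} with hl
  have hR : Tendsto (Prod.fst : ℝ × ℕ → ℝ) l atTop := tendsto_comap.mono_left inf_le_left
  have hmem : ∀ᶠ p in l, p.1 ≤ d p.2 ∧ d p.2 < p.1 + Δ :=
    eventually_inf_principal.2 (Eventually.of_forall fun _ h => h)
  have hn : Tendsto (Prod.snd : ℝ × ℕ → ℕ) l atTop := by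
    rw [tendsto_atTop]
    intro N
    obtain ⟨M, hM⟩ := ((Set.finite_lt_nat N).image d).bddAbove
    filter_upwards [hmem, hR.eventually_gt_atTop M] with p hp hpM
    by_contra hlt
    have := hM ⟨p.2, not_le.1 hlt, rfl⟩
    linarith [hp.1]
  have hdR : Tendsto (fun p : ℝ × ℕ => d p.2 / p.1) l (𝓝 1) := by
    have h1 : Tendsto (fun p : ℝ × ℕ => 1 + Δ / p.1) l (𝓝 1) := by
      simpa using ((tendsto_const_nhds (x := Δ)).div_atTop hR).const_add 1
    refine tendsto_of_tendsto_of_tendsto_of_le_of_le' tendsto_const_nhds h1 ?_ ?_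
    · filter_upwards [hmem, hR.eventually_gt_atTop 0] with p hp hp0
      rw [one_le_div hp0]; exact hp.1
    · filter_upwards [hmem, hR.eventually_gt_atTop 0] with p hp hp0
      rw [div_le_iff₀ hp0, add_mul, one_mul, div_mul_cancel₀ _ hp0.ne']; exact hp.2.le
  have hnR : Tendsto (fun p : ℝ × ℕ => Real.log p.2 / p.1) l (𝓝 (1 / 2)) := by
    have hz := Real.tendsto_log_atTop.comp (tendsto_natCast_atTop_atTop (R := ℝ))
    have h1 := hdR.mul (((tendsto_div_log hL ha hc hd).comp hn).inv₀ two_ne_zero)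
    rw [one_mul, ← one_div] at h1
    refine h1.congr' ?_
    filter_upwards [hmem, hR.eventually_gt_atTop 0] with p hp hp0
    have : 0 < d p.2 := hp0.trans_le hp.1
    simp only [Function.comp_apply]
    field_simp
  have h := tendsto_half_sub_log_add_logRadius hL ha hc hd hR hn hnR
  have h' := (Metric.tendsto_nhds.1 h) η hη
  rw [hl, eventually_inf_principal, eventually_comap] at h'
  filter_upwards [h'] with R hR n h1 h2
  simpa [Real.dist_eq] using hR (R, n) rfl ⟨h1, h2⟩

lemma eventually_abs_lt_of_log_mem (hL : IsSlowlyVarying L) (ha : 0 < a)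
    (hc : ContinuousOn L (Set.Ici a))
    (hd : Tendsto (fun n : ℕ => d n - 2 * halfDist α L n) atTop (𝓝 0)) {K η : ℝ}
    (hη : 0 < η) :
    ∀ᶠ R in atTop, ∀ n : ℕ, |Real.log n - logRadius α L R| ≤ K →
      |d n / 2 - Real.log n + (logRadius α L R - R / 2)| < η := by
  set l : Filter (ℝ × ℕ) := comap Prod.fst atTop ⊓
    𝓟 {p | |Real.log p.2 - logRadius α L p.1| ≤ K} with hl
  have hR : Tendsto (Prod.fst : ℝ × ℕ → ℝ) l atTop := tendsto_comap.mono_left inf_le_left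
  have hmem : ∀ᶠ p in l, |Real.log p.2 - logRadius α L p.1| ≤ K :=
    eventually_inf_principal.2 (Eventually.of_forall fun _ h => h)
  have hnR : Tendsto (fun p : ℝ × ℕ => Real.log p.2 / p.1) l (𝓝 (1 / 2)) := by
    have h1 : Tendsto (fun p : ℝ × ℕ => (Real.log p.2 - logRadius α L p.1) / p.1) l (𝓝 0) := by
      refine squeeze_zero_norm' ?_ ((tendsto_const_nhds (x := K)).div_atTop hR)
      filter_upwards [hmem, hR.eventually_gt_atTop 0] with p hp hp0
      rw [norm_div, Real.norm_eq_abs, Real.norm_of_nonneg hp0.le]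
      exact div_le_div_of_nonneg_right hp hp0.le
    have h2 := h1.add ((tendsto_logRadius_div hL ha hc α).comp hR)
    rw [zero_add] at h2
    refine h2.congr fun p => ?_
    rw [Function.comp_apply, ← add_div, sub_add_cancel]
  have hlogn : Tendsto (fun p : ℝ × ℕ => Real.log p.2) l atTop := by
    refine (Tendsto.pos_mul_atTop (by norm_num) hnR hR).congr' ?_
    filter_upwards [hR.eventually_gt_atTop 0] with p hp
    field_simp
  have hn : Tendsto (Prod.snd : ℝ × ℕ → ℕ) l atTop := by
    rw [← tendsto_natCast_atTop_iff (R := ℝ)]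
    refine tendsto_atTop_mono (fun p => ?_) hlogn
    exact Real.log_le_self (Nat.cast_nonneg _)
  have h := tendsto_half_sub_log_add_logRadius hL ha hc hd hR hn hnR
  have h' := (Metric.tendsto_nhds.1 h) η hη
  rw [hl, eventually_inf_principal, eventually_comap] at h'
  filter_upwards [h'] with R hR n h1
  simpa [Real.dist_eq] using hR (R, n) rfl h1

lemma exp_logWeight (hL : IsSlowlyVarying L) (α : ℝ) {R : ℝ} (hR : 0 < R) :
    R ^ α / L R = Real.exp (logWeight α L R) := by
  rw [logWeight, Real.exp_sub, Real.exp_log (hL.pos R hR.le), mul_comm,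
    Real.rpow_def_of_pos hR]

lemma mul_exp_neg_half (hL : IsSlowlyVarying L) (α : ℝ) {R : ℝ} (hR : 0 < R) {n : ℕ} (hn : 1 ≤ n)
    (x : ℝ) :
    R ^ α / L R * Real.exp (-(1 / 2) * x) =
      2 ^ α * ((n : ℝ))⁻¹ * Real.exp (-(x / 2 - Real.log n + (logRadius α L R - R / 2))) := by
  have hn0 : (0 : ℝ) < n := by exact_mod_cast hn
  rw [exp_logWeight hL α hR, Real.rpow_def_of_pos two_pos, ← Real.exp_log (inv_pos.2 hn0),
    ← Real.exp_add, ← Real.exp_add, ← Real.exp_add, Real.log_inv, logRadius]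
  congr 1
  ring

/-- The window lies between two intervals of log n whose endpoints are shifted by η, and each
normalized term is 2^α / n up to a factor e^{±η}. -/
lemma eventually_windowSum_bounds (hL : IsSlowlyVarying L) (ha : 0 < a)
    (hc : ContinuousOn L (Set.Ici a))
    (hd : Tendsto (fun n : ℕ => d n - 2 * halfDist α L n) atTop (𝓝 0)) {Δ η : ℝ}
    (hη : 0 < η) :
    ∀ᶠ R in atTop,
      2 ^ α * Real.exp (-η) *
          sumInvLog (logRadius α L R + η) (logRadius α L R + (Δ / 2 - η)) ≤
        R ^ α / L R * windowSum d Δ R ∧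
      R ^ α / L R * windowSum d Δ R ≤ 2 ^ α * Real.exp η *
          sumInvLog (logRadius α L R + (-η)) (logRadius α L R + (Δ / 2 + η)) := by
  filter_upwards [eventually_abs_lt_of_mem_window hL ha hc hd (Δ := Δ) hη,
    eventually_abs_lt_of_log_mem hL ha hc hd (K := Δ / 2 + η) hη, eventually_gt_atTop 0]
    with R h1 h2 hR
  set ρ := logRadius α L R with hρ
  set W : Set ℕ := {n | 1 ≤ n ∧ R ≤ d n ∧ d n < R + Δ} with hW
  set f : ℕ → ℝ := fun n => Real.exp (-(1 / 2) * d n) with hf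
  set Iout := Finset.Ioc ⌊Real.exp (ρ + (-η))⌋₊ ⌊Real.exp (ρ + (Δ / 2 + η))⌋₊ with hIout
  set Iin := Finset.Ioc ⌊Real.exp (ρ + η)⌋₊ ⌊Real.exp (ρ + (Δ / 2 - η))⌋₊ with hIin
  have hsub_out : ∀ n ∈ W, n ∈ Iout := by
    rintro n ⟨hn, h3, h4⟩
    have := abs_lt.1 (h1 n h3 h4)
    exact mem_Ioc_floor_exp_iff.2 ⟨hn, by linarith, by linarith⟩
  have hsub_in : ∀ n ∈ Iin, n ∈ W := by
    intro n hn
    obtain ⟨hn1, h3, h4⟩ := mem_Ioc_floor_exp_iff.1 hn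
    have := abs_lt.1 (h2 n (abs_le.2 ⟨by linarith, by linarith⟩))
    exact ⟨hn1, by linarith, by linarith⟩
  have hsum : windowSum d Δ R = ∑ n ∈ Iout, W.indicator f n :=
    tsum_eq_sum fun n hn => Set.indicator_of_notMem (fun h => hn (hsub_out n h)) f
  have hc0 : 0 < R ^ α / L R := by rw [exp_logWeight hL α hR]; exact Real.exp_pos _
  have hterm : ∀ n ∈ W, |d n / 2 - Real.log n + (ρ - R / 2)| < η := fun n hn => h1 n hn.2.1 hn.2.2
  rw [hsum, Finset.mul_sum, sumInvLog, sumInvLog, Finset.mul_sum, Finset.mul_sum]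
  constructor
  · calc _ ≤ ∑ n ∈ Iin, R ^ α / L R * W.indicator f n := by
          refine Finset.sum_le_sum fun n hn => ?_
          have hnW := hsub_in n hn
          rw [Set.indicator_of_mem hnW, hf, mul_exp_neg_half hL α hR hnW.1, mul_right_comm]
          gcongr
          exact (abs_lt.1 (hterm n hnW)).2.le
      _ ≤ _ := by
          refine Finset.sum_le_sum_of_subset_of_nonneg (fun n hn => hsub_out n (hsub_in n hn))
            fun n _ _ => mul_nonneg hc0.le (Set.indicator_nonneg (fun _ _ => (Real.exp_pos _).le) n)
  · refine Finset.sum_le_sum fun n hn => ?_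
    by_cases hnW : n ∈ W
    · rw [Set.indicator_of_mem hnW, hf, mul_exp_neg_half hL α hR hnW.1, mul_right_comm]
      gcongr
      linarith [(abs_lt.1 (hterm n hnW)).1]
    · rw [Set.indicator_of_notMem hnW, mul_zero]
      positivity

/-- The windows `[R, R + Δ)` of a sequence `d n = 2 (log n + α log log n - log L(log n)) + o(1)`. -/
theorem tendsto_mul_windowSum (hL : IsSlowlyVarying L) (ha : 0 < a)
    (hc : ContinuousOn L (Set.Ici a))
    (hd : Tendsto (fun n : ℕ => d n - 2 * halfDist α L n) atTop (𝓝 0)) {Δ : ℝ} (hΔ : 0 < Δ) :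
    Tendsto (fun R => R ^ α / L R * windowSum d Δ R) atTop (𝓝 (2 ^ (α - 1) * Δ)) := by
  have hval : (2 : ℝ) ^ (α - 1) * Δ = 2 ^ α * (Δ / 2) := by
    rw [Real.rpow_sub_one two_ne_zero]; ring
  rw [hval]
  have hρ := tendsto_logRadius hL ha hc α
  refine tendsto_order.2 ⟨fun b hb => ?_, fun b hb => ?_⟩
  · have hcont : Tendsto (fun η : ℝ => 2 ^ α * Real.exp (-η) * (Δ / 2 - η - η)) (𝓝[>] 0)
        (𝓝 (2 ^ α * (Δ / 2))) := by
      refine tendsto_nhdsWithin_of_tendsto_nhds ?_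
      have : Continuous (fun η : ℝ => (2 : ℝ) ^ α * Real.exp (-η) * (Δ / 2 - η - η)) := by fun_prop
      simpa using this.tendsto 0
    -- Keeps the inner interval from η to Δ/2 - η correctly ordered.
    have hsmall : ∀ᶠ η : ℝ in 𝓝[>] 0, η < Δ / 4 :=
      eventually_nhdsWithin_of_eventually_nhds (eventually_lt_nhds (by positivity))
    obtain ⟨η, h1, h2, h3⟩ := ((hcont.eventually_const_lt hb).and
      (hsmall.and self_mem_nhdsWithin)).exists
    have hη : 0 < η := h3
    have hlim := (tendsto_sumInvLog hρ (s := η) (t := Δ / 2 - η) (by linarith)).const_mul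
      (2 ^ α * Real.exp (-η))
    filter_upwards [hlim.eventually_const_lt h1, eventually_windowSum_bounds hL ha hc hd (Δ := Δ) hη]
      with R h4 h5
    exact h4.trans_le h5.1
  · have hcont : Tendsto (fun η : ℝ => 2 ^ α * Real.exp η * (Δ / 2 + η - -η)) (𝓝[>] 0)
        (𝓝 (2 ^ α * (Δ / 2))) := by
      refine tendsto_nhdsWithin_of_tendsto_nhds ?_
      have : Continuous (fun η : ℝ => (2 : ℝ) ^ α * Real.exp η * (Δ / 2 + η - -η)) := by fun_prop
      simpa using this.tendsto 0
    obtain ⟨η, h1, h3⟩ := ((hcont.eventually_lt_const hb).and self_mem_nhdsWithin).exists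
    have hη : 0 < η := h3
    have hlim := (tendsto_sumInvLog hρ (s := -η) (t := Δ / 2 + η) (by linarith)).const_mul
      (2 ^ α * Real.exp η)
    filter_upwards [hlim.eventually_lt_const h1, eventually_windowSum_bounds hL ha hc hd (Δ := Δ) hη]
      with R h4 h5
    exact h5.2.trans_lt h4

end LogarithmicWindows

/-! ### Convergence of the series at exponent 1/2 when α > 1. -/

section Convergence

variable {α a : ℝ} {L : ℝ → ℝ} {d : ℕ → ℝ}

/-- Cauchy condensation reduces this to the series of k^{-β}. -/
lemma summable_inv_mul_log_rpow {β : ℝ} (hβ : 1 < β) :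
    Summable fun n : ℕ => ((n : ℝ) * Real.log n ^ β)⁻¹ := by
  rw [← summable_condensed_iff_of_eventually_nonneg]
  · have h : Summable fun k : ℕ => (Real.log 2 ^ β)⁻¹ * ((k : ℝ) ^ β)⁻¹ :=
      (Real.summable_nat_rpow_inv.2 hβ).mul_left _
    refine h.congr fun k => ?_
    push_cast
    rw [Real.log_pow, Real.mul_rpow (Nat.cast_nonneg k) (Real.log_nonneg one_le_two), mul_inv,
      mul_inv]
    field_simp
  · exact Eventually.of_forall fun n => by
      have := Real.log_natCast_nonneg n
      simp only [Pi.zero_apply]; positivity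
  · filter_upwards [eventually_ge_atTop 2] with n hn
    have h1 : (1 : ℝ) < n := by exact_mod_cast hn
    have h2 : 0 < Real.log n := Real.log_pos h1
    gcongr <;> simp

lemma summable_exp_neg_half (hL : IsSlowlyVarying L) (ha : 0 < a)
    (hc : ContinuousOn L (Set.Ici a)) (hα : 1 < α)
    (hd : Tendsto (fun n : ℕ => d n - 2 * halfDist α L n) atTop (𝓝 0)) :
    Summable fun n => Real.exp (-(1 / 2) * d n) := by
  -- L(log n) costs at most (log n)^((α-1)/2), leaving the exponent (1 + α)/2 > 1 on log n.
  obtain ⟨C, hC⟩ := hL.exists_abs_log_le ha hc (ε := (α - 1) / 2) (by linarith)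
  have hsum := (summable_inv_mul_log_rpow (β := (1 + α) / 2) (by linarith)).mul_left
    (Real.exp (C + 1))
  have hz := Real.tendsto_log_atTop.comp (tendsto_natCast_atTop_atTop (R := ℝ))
  refine summable_of_isBigO_nat hsum (Asymptotics.IsBigO.of_bound 1 ?_)
  filter_upwards [hd.eventually_const_lt (by norm_num : (-1 : ℝ) < 0),
    hz.eventually_ge_atTop a, hz.eventually_ge_atTop 1, eventually_gt_atTop 0] with n h1 h2 h3 h4
  have hn : (0 : ℝ) < n := by exact_mod_cast h4
  simp only [Function.comp_apply] at h2 h3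
  have hln : 0 < Real.log n := by linarith
  have h5 := (abs_le.1 (hC _ h2 h3)).2
  rw [one_mul, Real.norm_of_nonneg (Real.exp_pos _).le, Real.norm_of_nonneg (by positivity),
    ← Real.exp_log (by positivity : (0 : ℝ) < (n * Real.log n ^ ((1 + α) / 2))⁻¹), ← Real.exp_add,
    Real.exp_le_exp, Real.log_inv, Real.log_mul hn.ne' (by positivity), Real.log_rpow hln]
  simp only [halfDist, logWeight] at h1
  linarith

end Convergence

/-! ### Counting integers with e n ≤ R when e n ~ 2 log|n|. -/

section Counting

variable {e : ℤ → ℝ}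

lemma finite_int_abs_le (K : ℝ) : {n : ℤ | |(n : ℝ)| ≤ K}.Finite := by
  refine (Set.finite_Icc (-⌊K⌋) ⌊K⌋).subset fun n hn => ?_
  have hn' : |(n : ℝ)| ≤ K := hn
  have h := abs_le.1 hn'
  exact ⟨neg_le.1 (Int.le_floor.2 (by push_cast; linarith [h.1])), Int.le_floor.2 h.2⟩

lemma eventually_cofinite_lt_log_abs (K : ℝ) :
    ∀ᶠ n : ℤ in cofinite, K < Real.log |(n : ℝ)| := by
  refine (finite_int_abs_le (Real.exp (max K 0))).subset fun n hn => ?_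
  by_contra h
  refine hn ((le_max_left K 0).trans_lt ?_)
  have h' : Real.exp (max K 0) < |(n : ℝ)| := not_le.1 fun hle => h hle
  exact (Real.lt_log_iff_exp_lt ((Real.exp_pos _).trans h')).2 h'

lemma exists_log_abs_le (he : Tendsto (fun n : ℤ => e n / Real.log |(n : ℝ)|) cofinite (𝓝 2))
    {β : ℝ} (hβ : 1 / 2 < β) : ∃ M, 0 ≤ M ∧ ∀ n : ℤ, Real.log |(n : ℝ)| ≤ β * e n + M := by
  have h1 : ∀ᶠ n : ℤ in cofinite, Real.log |(n : ℝ)| ≤ β * e n := by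
    have hlt : 1 / β < 2 := by
      rw [div_lt_iff₀ (by linarith)]; linarith
    filter_upwards [he.eventually_const_lt hlt, eventually_cofinite_lt_log_abs 0] with n hn hn0
    rw [div_lt_div_iff₀ (by linarith) hn0] at hn
    linarith
  obtain ⟨M, hM⟩ := (h1.image fun n : ℤ => Real.log |(n : ℝ)| - β * e n).bddAbove
  refine ⟨max M 0, le_max_right _ _, fun n => ?_⟩
  by_cases hn : Real.log |(n : ℝ)| ≤ β * e n
  · linarith [le_max_right M 0]
  · have := hM ⟨n, hn, rfl⟩
    simp only at this
    linarith [le_max_left M 0]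

lemma finite_setOf_le (he : Tendsto (fun n : ℤ => e n / Real.log |(n : ℝ)|) cofinite (𝓝 2))
    (R : ℝ) : {n | e n ≤ R}.Finite := by
  obtain ⟨M, -, hM⟩ := exists_log_abs_le he (by norm_num : (1 : ℝ) / 2 < 1)
  refine (finite_int_abs_le (Real.exp (R + M))).subset fun n hn => ?_
  have h1 : Real.log |(n : ℝ)| ≤ R + M := by
    have : e n ≤ R := hn
    linarith [hM n]
  -- At n = 0 the default value `Real.log 0 = 0` carries no information, so this integer is treated
  -- separately.
  rcases eq_or_ne n 0 with rfl | h0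
  · simpa using (Real.exp_pos (R + M)).le
  · exact (Real.log_le_iff_le_exp (by simpa using h0)).1 h1

lemma exists_log_ncard_le
    (he : Tendsto (fun n : ℤ => e n / Real.log |(n : ℝ)|) cofinite (𝓝 2)) {β : ℝ}
    (hβ : 1 / 2 < β) :
    ∃ C, ∀ R, 0 ≤ R → Real.log ({n | e n ≤ R}.ncard) ≤ β * R + C := by
  obtain ⟨M, hM0, hM⟩ := exists_log_abs_le he hβ
  refine ⟨Real.log 3 + M, fun R hR => ?_⟩
  set X := Real.exp (β * R + M) with hX
  have hX1 : 1 ≤ X := Real.one_le_exp (by positivity)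
  have hsub : {n | e n ≤ R} ⊆ (Finset.Icc (-⌊X⌋) ⌊X⌋ : Finset ℤ) := fun n hn => by
    have h1 : |(n : ℝ)| ≤ X := by
      rcases eq_or_ne n 0 with rfl | h0
      · simpa using (zero_le_one.trans hX1)
      · refine (Real.log_le_iff_le_exp (by simpa using h0)).1 ((hM n).trans ?_)
        have : β * e n ≤ β * R := mul_le_mul_of_nonneg_left hn (by linarith)
        linarith
    have h := abs_le.1 h1
    rw [Finset.coe_Icc]
    exact ⟨neg_le.1 (Int.le_floor.2 (by push_cast; linarith [h.1])), Int.le_floor.2 h.2⟩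
  have hcard : ({n | e n ≤ R}.ncard : ℝ) ≤ 3 * X := by
    have h1 := Set.ncard_le_ncard hsub (Finset.finite_toSet _)
    rw [Set.ncard_coe_finset, Int.card_Icc] at h1
    have hfl : 0 ≤ ⌊X⌋ := Int.floor_nonneg.2 (zero_le_one.trans hX1)
    have h2 : (({n | e n ≤ R}.ncard : ℤ) : ℝ) ≤ ((2 * ⌊X⌋ + 1 : ℤ) : ℝ) := by
      exact_mod_cast (by omega : ({n | e n ≤ R}.ncard : ℤ) ≤ 2 * ⌊X⌋ + 1)
    push_cast at h2
    linarith [Int.floor_le X]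
  have h3X : Real.log (3 * X) = β * R + (Real.log 3 + M) := by
    rw [Real.log_mul three_ne_zero (Real.exp_pos _).ne', Real.log_exp]; ring
  rw [← h3X]
  rcases Nat.eq_zero_or_pos {n | e n ≤ R}.ncard with h0 | h0
  · rw [h0, Nat.cast_zero, Real.log_zero]
    exact Real.log_nonneg (by linarith)
  · exact Real.log_le_log (by exact_mod_cast h0) hcard

lemma eventually_exp_le_ncard
    (he : Tendsto (fun n : ℤ => e n / Real.log |(n : ℝ)|) cofinite (𝓝 2)) {β : ℝ}
    (hβ0 : 0 < β) (hβ : β < 1 / 2) :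
    ∀ᶠ R in atTop, Real.exp (β * R) / 2 ≤ ({n | e n ≤ R}.ncard : ℝ) := by
  have h1 : ∀ᶠ n : ℤ in cofinite, β * e n ≤ Real.log |(n : ℝ)| := by
    have hlt : 2 < 1 / β := by
      rw [lt_div_iff₀ hβ0]; linarith
    filter_upwards [he.eventually_lt_const hlt, eventually_cofinite_lt_log_abs 0] with n hn hn0
    rw [div_lt_div_iff₀ hn0 hβ0] at hn
    linarith
  have hF : {n : ℤ | ¬ β * e n ≤ Real.log |(n : ℝ)|}.Finite := h1
  have htop : Tendsto (fun R => Real.exp (β * R)) atTop atTop :=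
    Real.tendsto_exp_atTop.comp (tendsto_id.const_mul_atTop hβ0)
  -- All integers in [1, exp(β R)] count except the finitely many in F; the threshold lets half of
  -- exp(β R) absorb |F| and the rounding.
  filter_upwards [htop.eventually_ge_atTop (2 * (1 + hF.toFinset.card))] with R hR
  have hsub : ((Finset.Icc 1 ⌊Real.exp (β * R)⌋ \ hF.toFinset : Finset ℤ) : Set ℤ) ⊆
      {n | e n ≤ R} := fun n hn => by
    rw [Finset.mem_coe, Finset.mem_sdiff, Finset.mem_Icc, Set.Finite.mem_toFinset] at hn
    obtain ⟨⟨hn1, hn2⟩, hn3⟩ := hn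
    have hn3 : β * e n ≤ Real.log |(n : ℝ)| := not_not.1 hn3
    have hn0 : (0 : ℝ) < n := by exact_mod_cast hn1
    rw [abs_of_pos hn0] at hn3
    have h2 := (Real.log_le_iff_le_exp hn0).2 (Int.le_floor.1 hn2)
    exact le_of_mul_le_mul_left (hn3.trans h2) hβ0
  have hcard := Set.ncard_le_ncard hsub (finite_setOf_le he R)
  rw [Set.ncard_coe_finset] at hcard
  have h2 := Finset.le_card_sdiff hF.toFinset (Finset.Icc 1 ⌊Real.exp (β * R)⌋)
  rw [Int.card_Icc] at h2
  have h3 : ⌊Real.exp (β * R)⌋ ≤ ({n | e n ≤ R}.ncard : ℤ) + hF.toFinset.card := by omega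
  have h4 : (⌊Real.exp (β * R)⌋ : ℝ) ≤ ({n | e n ≤ R}.ncard : ℝ) + hF.toFinset.card := by
    exact_mod_cast h3
  linarith [Int.lt_floor_add_one (Real.exp (β * R))]

lemma tendsto_log_ncard_div
    (he : Tendsto (fun n : ℤ => e n / Real.log |(n : ℝ)|) cofinite (𝓝 2)) :
    Tendsto (fun R => Real.log ({n | e n ≤ R}.ncard) / R) atTop (𝓝 (1 / 2)) := by
  refine tendsto_order.2 ⟨fun b hb => ?_, fun b hb => ?_⟩
  · obtain ⟨β, hβ1, hβ2⟩ := exists_between (max_lt hb (by norm_num : (0 : ℝ) < 1 / 2))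
    have hlim : Tendsto (fun R : ℝ => β - Real.log 2 / R) atTop (𝓝 β) := by
      simpa using ((tendsto_const_nhds (x := Real.log 2)).div_atTop tendsto_id).const_sub β
    filter_upwards [eventually_exp_le_ncard he ((le_max_right _ _).trans_lt hβ1) hβ2,
      hlim.eventually_const_lt ((le_max_left _ _).trans_lt hβ1), eventually_gt_atTop 0]
      with R h1 h2 h3
    refine h2.trans_le ?_
    have := Real.log_le_log (by positivity) h1
    rw [Real.log_div (Real.exp_pos _).ne' two_ne_zero, Real.log_exp] at this
    rw [le_div_iff₀ h3, sub_mul, div_mul_cancel₀ _ h3.ne']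
    exact this
  · obtain ⟨β, hβ1, hβ2⟩ := exists_between hb
    obtain ⟨C, hC⟩ := exists_log_ncard_le he hβ1
    have hlim : Tendsto (fun R : ℝ => β + C / R) atTop (𝓝 β) := by
      simpa using ((tendsto_const_nhds (x := C)).div_atTop tendsto_id).const_add β
    filter_upwards [hlim.eventually_lt_const hβ2, eventually_gt_atTop 0] with R h2 h3
    refine lt_of_le_of_lt ?_ h2
    rw [div_le_iff₀ h3, add_mul, div_mul_cancel₀ _ h3.ne']
    exact hC R h3.le

end Counting

/-! ### Transfer from ⟨p⟩ to ℤ and orbit sums of the group. -/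

section CyclicOrbits

lemma unitTranslation_pow_apply (n : ℕ) (z : ℝ × ℝ) :
    (unitTranslation ^ n) z = (z.1 + n, z.2) := by
  induction n with
  | zero => simp
  | succ n ih =>
    rw [pow_succ', Equiv.Perm.mul_apply, ih]
    ext <;> simp [unitTranslation, add_assoc]

lemma unitTranslation_zpow_apply (n : ℤ) (z : ℝ × ℝ) :
    (unitTranslation ^ n) z = (z.1 + n, z.2) := by
  obtain ⟨m, rfl | rfl⟩ := n.eq_nat_or_neg
  · rw [zpow_natCast, unitTranslation_pow_apply, Int.cast_natCast]
  · rw [zpow_neg, zpow_natCast, Equiv.Perm.inv_eq_iff_eq, unitTranslation_pow_apply]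
    ext <;> simp

lemma unitTranslation_zpow_injective :
    Function.Injective fun n : ℤ => unitTranslation ^ n := by
  intro m n h
  have h1 := congrArg (fun γ : Equiv.Perm (ℝ × ℝ) => (γ (0, 0)).1) h
  simpa [unitTranslation_zpow_apply] using h1

lemma tsum_zpowers_subtype (P : Equiv.Perm (ℝ × ℝ) → Prop) (f : Equiv.Perm (ℝ × ℝ) → ℝ) :
    ∑' γ : {γ // γ ∈ Subgroup.zpowers unitTranslation ∧ P γ}, f γ =
      ∑' n : ℤ, Set.indicator {n | P (unitTranslation ^ n)} (fun n => f (unitTranslation ^ n)) n := by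
  have h1 : ∑' γ : {γ // γ ∈ Subgroup.zpowers unitTranslation ∧ P γ}, f γ =
      ∑' γ, Set.indicator {γ | γ ∈ Subgroup.zpowers unitTranslation ∧ P γ} f γ :=
    tsum_subtype {γ | γ ∈ Subgroup.zpowers unitTranslation ∧ P γ} f
  rw [h1, ← unitTranslation_zpow_injective.tsum_eq]
  · refine tsum_congr fun n => ?_
    by_cases h : P (unitTranslation ^ n)
    · rw [Set.indicator_of_mem (show n ∈ {n | P (unitTranslation ^ n)} from h),
        Set.indicator_of_mem (show _ ∈ {γ | γ ∈ Subgroup.zpowers unitTranslation ∧ P γ} from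
          ⟨Subgroup.zpow_mem_zpowers _ _, h⟩)]
    · rw [Set.indicator_of_notMem (show n ∉ {n | P (unitTranslation ^ n)} from h),
        Set.indicator_of_notMem (fun hh => h hh.2)]
  · intro γ hγ
    obtain ⟨n, rfl⟩ := Subgroup.mem_zpowers_iff.1 (Set.mem_of_indicator_ne_zero hγ).1
    exact ⟨n, rfl⟩

lemma orbitalFunction_zpowers (d : ℝ × ℝ → ℝ × ℝ → ℝ) (x y : ℝ × ℝ) (R : ℝ) :
    orbitalFunction d (Subgroup.zpowers unitTranslation) x y R =
      {n : ℤ | d x ((unitTranslation ^ n) y) ≤ R}.encard := by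
  rw [orbitalFunction, ← unitTranslation_zpow_injective.encard_image]
  congr 1
  ext γ
  constructor
  · rintro ⟨h1, h2⟩
    obtain ⟨n, rfl⟩ := Subgroup.mem_zpowers_iff.1 h1
    exact ⟨n, h2, rfl⟩
  · rintro ⟨n, h1, rfl⟩
    exact ⟨Subgroup.zpow_mem_zpowers _ _, h1⟩

lemma poincareSeries_zpowers (d : ℝ × ℝ → ℝ × ℝ → ℝ) (x y : ℝ × ℝ) (s : ℝ) :
    poincareSeries d (Subgroup.zpowers unitTranslation) x y s =
      ∑' n : ℤ, ENNReal.ofReal (Real.exp (-s * d x ((unitTranslation ^ n) y))) := by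
  have hbij : Function.Bijective fun n : ℤ =>
      (⟨unitTranslation ^ n, Subgroup.zpow_mem_zpowers _ _⟩ :
        Subgroup.zpowers unitTranslation) := by
    refine ⟨fun m n h => unitTranslation_zpow_injective (congrArg Subtype.val h), ?_⟩
    rintro ⟨γ, hγ⟩
    obtain ⟨n, rfl⟩ := Subgroup.mem_zpowers_iff.1 hγ
    exact ⟨n, rfl⟩
  exact ((Equiv.ofBijective _ hbij).tsum_eq _).symm

lemma poincareExponent_zpowers {d : ℝ × ℝ → ℝ × ℝ → ℝ} {x y : ℝ × ℝ}
    (h : Tendsto (fun n : ℤ => d x ((unitTranslation ^ n) y) / Real.log |(n : ℝ)|) cofinite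
      (𝓝 2)) :
    poincareExponent d (Subgroup.zpowers unitTranslation) x y = ((1 / 2 : ℝ) : EReal) := by
  refine Tendsto.limsup_eq ?_
  have h1 := continuous_coe_real_ereal.tendsto _ |>.comp (tendsto_log_ncard_div h)
  refine h1.congr' ?_
  -- Any β in (0, 1/2) would do: the count only has to be positive for the extended and real
  -- logarithms to agree.
  filter_upwards [eventually_exp_le_ncard h (by norm_num : (0 : ℝ) < 1 / 4) (by norm_num)]
    with R hR
  have hpos : (0 : ℝ) < {n : ℤ | d x ((unitTranslation ^ n) y) ≤ R}.ncard :=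
    lt_of_lt_of_le (by positivity) hR
  rw [orbitalFunction_zpowers, ← (finite_setOf_le h R).cast_ncard_eq, Function.comp_apply,
    EReal.coe_div]
  congr 1
  rw [← ENNReal.log_ofReal_of_pos hpos]
  simp

variable {T : ℝ → ℝ}

/-- From (n, 0) to p^n y a horizontal and a vertical segment suffice, of lengths independent of n.
This reduces all base points to o. -/
lemma abs_warpedDist_zpow_sub_le (hT : ∀ t, 0 < T t) (x y : ℝ × ℝ) :
    ∃ C, ∀ n : ℤ, |warpedDist T x ((unitTranslation ^ n) y) - warpedDist T (0, 0) ((n : ℝ), 0)| ≤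
      C := by
  refine ⟨warpedDist T x (0, 0) + (T 0 * |y.1| + |y.2|), fun n => ?_⟩
  rw [unitTranslation_zpow_apply]
  have h1 := warpedDist_triangle hT x (0, 0) (y.1 + n, y.2)
  have h2 := warpedDist_triangle hT (0, 0) ((n : ℝ), 0) (y.1 + n, y.2)
  have h3 := warpedDist_triangle hT ((n : ℝ), 0) (y.1 + n, 0) (y.1 + n, y.2)
  have h4 := warpedDist_horizontal_le hT (n : ℝ) (y.1 + n) 0
  have h5 := warpedDist_vertical_le (T := T) (y.1 + n) 0 y.2
  have h6 := warpedDist_triangle hT (0, 0) x ((n : ℝ), 0)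
  have h7 := warpedDist_triangle hT x (y.1 + n, y.2) ((n : ℝ), 0)
  have e1 : |(n : ℝ) - (y.1 + n)| = |y.1| := by rw [← abs_neg]; congr 1; ring
  rw [e1] at h4
  rw [zero_sub, abs_neg] at h5
  rw [warpedDist_comm (0, 0) x] at h6
  rw [warpedDist_comm (y.1 + (n : ℝ), y.2)] at h7
  rw [abs_le]
  constructor <;> linarith

variable {α A B a : ℝ} {L : ℝ → ℝ}

lemma IsCuspProfile.tendsto_warpedDist_nat_sub (hT : IsCuspProfile α L A B a T)
    (hL : IsSlowlyVarying L) : Tendsto (fun n : ℕ => warpedDist T (0, 0) ((n : ℝ), 0) -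
      2 * halfDist α L n) atTop (𝓝 0) := by
  have h := hT.tendsto_warpedDist_sub hL (l := atTop) (x := fun n : ℕ => (n : ℝ))
    (by simpa using tendsto_natCast_atTop_atTop (R := ℝ))
  simpa using h

lemma IsCuspProfile.tendsto_warpedDist_neg_nat_sub (hT : IsCuspProfile α L A B a T)
    (hL : IsSlowlyVarying L) : Tendsto (fun n : ℕ => warpedDist T (0, 0) (-(n : ℝ), 0) -
      2 * halfDist α L n) atTop (𝓝 0) := by
  have h := hT.tendsto_warpedDist_sub hL (l := atTop) (x := fun n : ℕ => -(n : ℝ))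
    (by simpa using tendsto_natCast_atTop_atTop (R := ℝ))
  simpa using h

lemma IsCuspProfile.tendsto_warpedDist_zpow_div (hT : IsCuspProfile α L A B a T)
    (hL : IsSlowlyVarying L) (x y : ℝ × ℝ) :
    Tendsto (fun n : ℤ => warpedDist T x ((unitTranslation ^ n) y) / Real.log |(n : ℝ)|) cofinite
      (𝓝 2) := by
  have habs : Tendsto (fun n : ℤ => |(n : ℝ)|) cofinite atTop := by
    refine tendsto_atTop.2 fun K => ?_
    refine (finite_int_abs_le K).subset fun n hn => ?_
    exact (not_le.1 fun hle : K ≤ |(n : ℝ)| => hn hle).le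
  have hlog := Real.tendsto_log_atTop.comp habs
  obtain ⟨C, hC⟩ := abs_warpedDist_zpow_sub_le hT.pos x y
  have h1 := (hT.tendsto_halfDist_div hL habs).const_mul 2
  have h2 := (hT.tendsto_warpedDist_sub hL habs).div_atTop hlog
  have h3 : Tendsto (fun n : ℤ => (warpedDist T x ((unitTranslation ^ n) y) -
      warpedDist T (0, 0) ((n : ℝ), 0)) / Real.log |(n : ℝ)|) cofinite (𝓝 0) := by
    refine squeeze_zero_norm' ?_ ((tendsto_const_nhds (x := C)).div_atTop hlog)
    filter_upwards [hlog.eventually_gt_atTop 0] with n hn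
    simp only [Function.comp_apply] at hn ⊢
    rw [norm_div, Real.norm_eq_abs, Real.norm_of_nonneg hn.le]
    exact div_le_div_of_nonneg_right (hC n) hn.le
  have h4 := (h1.add h2).add h3
  rw [mul_one, add_zero, add_zero] at h4
  refine h4.congr fun n => ?_
  simp only [Function.comp_apply]
  ring

lemma IsCuspProfile.summable_exp_warpedDist (hT : IsCuspProfile α L A B a T)
    (hL : IsSlowlyVarying L) (hα : 1 < α) (x y : ℝ × ℝ) :
    Summable fun n : ℤ => Real.exp (-(1 / 2) * warpedDist T x ((unitTranslation ^ n) y)) := by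
  have hc := hT.continuousOn_slowlyVarying hL
  have h1 := summable_exp_neg_half hL hT.a_pos hc hα (hT.tendsto_warpedDist_nat_sub hL)
  have h2 := summable_exp_neg_half hL hT.a_pos hc hα (hT.tendsto_warpedDist_neg_nat_sub hL)
  have h3 : Summable fun n : ℤ => Real.exp (-(1 / 2) * warpedDist T (0, 0) ((n : ℝ), 0)) :=
    Summable.of_nat_of_neg (by simpa using h1) (by simpa using h2)
  obtain ⟨C, hC⟩ := abs_warpedDist_zpow_sub_le hT.pos x y
  refine Summable.of_nonneg_of_le (fun n => (Real.exp_pos _).le) (fun n => ?_)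
    (h3.mul_left (Real.exp (C / 2)))
  rw [← Real.exp_add, Real.exp_le_exp]
  linarith [(abs_le.1 (hC n)).1]

lemma windowSum_eq_tsum_indicator {d : ℕ → ℝ} (hd : d 0 = 0) {Δ R : ℝ} (hR : 0 < R) :
    windowSum d Δ R = ∑' n : ℕ, Set.indicator {n | R ≤ d n ∧ d n < R + Δ}
      (fun n => Real.exp (-(1 / 2) * d n)) n := by
  have hset : {n | 1 ≤ n ∧ R ≤ d n ∧ d n < R + Δ} = {n | R ≤ d n ∧ d n < R + Δ} := by
    ext n
    simp only [Set.mem_ofPred_eq, and_iff_right_iff_imp]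
    rintro ⟨h1, -⟩
    by_contra h0
    have : n = 0 := by omega
    subst this
    linarith
  rw [windowSum, hset]

lemma summable_indicator_window {d : ℕ → ℝ} (hd : Tendsto d atTop atTop) (Δ R : ℝ) :
    Summable fun n : ℕ => Set.indicator {n | R ≤ d n ∧ d n < R + Δ}
      (fun n => Real.exp (-(1 / 2) * d n)) n := by
  obtain ⟨N, hN⟩ := eventually_atTop.1 (hd.eventually_ge_atTop (R + Δ))
  refine summable_of_ne_finset_zero (s := Finset.range N) fun n hn => ?_
  refine Set.indicator_of_notMem (fun h => ?_) _
  exact absurd h.2 (not_lt.2 (hN n (by simpa using hn)))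

/-- Positive and negative powers each contribute 2^(α-1) Δ, since the distance asymptotics only
involve |x|. -/
lemma IsCuspProfile.hasOrbitalTail (hT : IsCuspProfile α L A B a T) (hL : IsSlowlyVarying L) :
    HasOrbitalTail (warpedDist T) (0, 0) (Subgroup.zpowers unitTranslation) (1 / 2) α L
      (2 ^ α) := by
  intro Δ hΔ
  have hc := hT.continuousOn_slowlyVarying hL
  have hd1 := hT.tendsto_warpedDist_nat_sub hL
  have hd2 := hT.tendsto_warpedDist_neg_nat_sub hL
  have h := (tendsto_mul_windowSum hL hT.a_pos hc hd1 hΔ).add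
    (tendsto_mul_windowSum hL hT.a_pos hc hd2 hΔ)
  rw [show (2 : ℝ) ^ (α - 1) * Δ + 2 ^ (α - 1) * Δ = 2 ^ α * Δ by
    rw [Real.rpow_sub_one two_ne_zero]; ring] at h
  refine h.congr' ?_
  filter_upwards [eventually_gt_atTop 0] with R hR
  rw [← mul_add]
  congr 1
  have hs1 := summable_indicator_window (tendsto_atTop_of_sub_halfDist hL hT.a_pos hc hd1) Δ R
  have hs2 := summable_indicator_window (tendsto_atTop_of_sub_halfDist hL hT.a_pos hc hd2) Δ R
  rw [windowSum_eq_tsum_indicator (by simp [warpedDist_self]) hR,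
    windowSum_eq_tsum_indicator (by simp [warpedDist_self]) hR,
    tsum_zpowers_subtype (fun γ => R ≤ warpedDist T (0, 0) (γ (0, 0)) ∧
      warpedDist T (0, 0) (γ (0, 0)) < R + Δ)
      (fun γ => Real.exp (-(1 / 2) * warpedDist T (0, 0) (γ (0, 0))))]
  simp only [unitTranslation_zpow_apply, zero_add]
  set G : ℤ → ℝ := Set.indicator {n : ℤ | R ≤ warpedDist T (0, 0) ((n : ℝ), 0) ∧
    warpedDist T (0, 0) ((n : ℝ), 0) < R + Δ}
    (fun n : ℤ => Real.exp (-(1 / 2) * warpedDist T (0, 0) ((n : ℝ), 0))) with hG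
  have e1 : ∀ n : ℕ, Set.indicator {n : ℕ | R ≤ warpedDist T (0, 0) ((n : ℝ), 0) ∧
      warpedDist T (0, 0) ((n : ℝ), 0) < R + Δ}
      (fun n : ℕ => Real.exp (-(1 / 2) * warpedDist T (0, 0) ((n : ℝ), 0))) n = G n := fun n => by
    simp only [hG, Set.indicator, Set.mem_ofPred_eq, Int.cast_natCast]
  have e2 : ∀ n : ℕ, Set.indicator {n : ℕ | R ≤ warpedDist T (0, 0) (-(n : ℝ), 0) ∧
      warpedDist T (0, 0) (-(n : ℝ), 0) < R + Δ}
      (fun n : ℕ => Real.exp (-(1 / 2) * warpedDist T (0, 0) (-(n : ℝ), 0))) n = G (-n) :=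
    fun n => by
      simp only [hG, Set.indicator, Set.mem_ofPred_eq, Int.cast_neg, Int.cast_natCast]
  have hG0 : G 0 = 0 := by
    refine Set.indicator_of_notMem (fun hh => ?_) _
    have := hh.1
    rw [Int.cast_zero, warpedDist_self] at this
    linarith
  simp only [e1, e2] at hs1 hs2 ⊢
  -- The term n = 0 is counted in both halves, but it vanishes because d(o, o) = 0 < R.
  rw [Summable.tsum_of_nat_of_neg hs1 hs2, hG0, sub_zero]

end CyclicOrbits

end

theorem mainTheorem6 (α : ℝ) (L : ℝ → ℝ) (hL : IsSlowlyVarying L) (A B a : ℝ) (T : ℝ → ℝ)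
    (hT : IsCuspProfile α L A B a T) :
    -- asymptotics of the distances `d(o, pⁿ o)`
    Tendsto (fun n : ℕ =>
        warpedDist T (0, 0) ((unitTranslation ^ n) (0, 0)) -
          2 * (Real.log n + α * Real.log (Real.log n) - Real.log (L (Real.log n))))
      atTop (𝓝 0) ∧
    -- the Poincaré exponent of `⟨p⟩` is `1 / 2`
    (∀ x y : ℝ × ℝ, poincareExponent (warpedDist T) (Subgroup.zpowers unitTranslation) x y =
      ((1 / 2 : ℝ) : EReal)) ∧
    -- `⟨p⟩` is convergent for `α > 1`
    (1 < α → IsConvergentGroup (warpedDist T) (Subgroup.zpowers unitTranslation)) ∧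
    -- the tail asymptotics, first over the positive powers of `p`, then over `⟨p⟩`
    (∀ Δ : ℝ, 0 < Δ →
      Tendsto (fun R : ℝ => R ^ α / L R *
        ∑' n : {n : ℕ // 1 ≤ n ∧ R ≤ warpedDist T (0, 0) ((unitTranslation ^ n) (0, 0)) ∧
            warpedDist T (0, 0) ((unitTranslation ^ n) (0, 0)) < R + Δ},
          Real.exp (-(1 / 2) * warpedDist T (0, 0) ((unitTranslation ^ (n : ℕ)) (0, 0))))
        atTop (𝓝 (2 ^ (α - 1) * Δ))) ∧
    HasOrbitalTail (warpedDist T) (0, 0) (Subgroup.zpowers unitTranslation) (1 / 2) α L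
      (2 ^ α) := by
  have hnat : ∀ n : ℕ, (unitTranslation ^ n) ((0 : ℝ), (0 : ℝ)) = ((n : ℝ), 0) := fun n => by
    rw [unitTranslation_pow_apply, zero_add]
  have hexp : ∀ x y : ℝ × ℝ, poincareExponent (warpedDist T)
      (Subgroup.zpowers unitTranslation) x y = ((1 / 2 : ℝ) : EReal) := fun x y =>
    poincareExponent_zpowers (hT.tendsto_warpedDist_zpow_div hL x y)
  refine ⟨?_, hexp, fun hα => ⟨1 / 2, fun x y => ⟨hexp x y, ?_⟩⟩, fun Δ hΔ => ?_,
    hT.hasOrbitalTail hL⟩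
  · refine (hT.tendsto_warpedDist_nat_sub hL).congr fun n => ?_
    rw [hnat, halfDist, logWeight, add_sub_assoc]
  · rw [poincareSeries_zpowers]
    exact (hT.summable_exp_warpedDist hL hα x y).tsum_ofReal_lt_top
  · have hd : Tendsto (fun n : ℕ => warpedDist T (0, 0) ((unitTranslation ^ n) (0, 0)) -
        2 * halfDist α L n) atTop (𝓝 0) := by
      simpa only [hnat] using hT.tendsto_warpedDist_nat_sub hL
    refine (tendsto_mul_windowSum hL hT.a_pos (hT.continuousOn_slowlyVarying hL) hd hΔ).congr
      fun R => ?_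
    congr 1
    exact (tsum_subtype {n : ℕ | 1 ≤ n ∧
      R ≤ warpedDist T (0, 0) ((unitTranslation ^ n) (0, 0)) ∧
      warpedDist T (0, 0) ((unitTranslation ^ n) (0, 0)) < R + Δ}
      (fun n : ℕ => Real.exp (-(1 / 2) *
        warpedDist T (0, 0) ((unitTranslation ^ n) (0, 0))))).symm
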